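/- Let $\omega=e^{i\pi/4}$ and consider the quantum gates \[ X=\begin{bmatrix}0&1\\1&0\end{bmatrix},\quad CX=I_2\oplus X,\quad CCX=I_6\oplus X,\quad \omega H=\frac{\omega}{\sqrt2}\begin{bmatrix}1&1\\1&-1\end{bmatrix},\quad S=\begin{bmatrix}1&0\\0&i\end{bmatrix}. \] An ancilla-free $n$-qubit circuit over $\{X,CX,CCX,\omega H,S\}$ is a finite sequence of gates from this set, each applied to distinct qubits among the $n$ given ones (and acting as the identity on the others); it exactly represents the $2^n\times 2^n$ matrix $V$ if the product of these gates is equal to $V$ (global phase included). Let $U_{2^n}(\mathbb{Z}[1/2,i])$ be the group of $2^n\times 2^n$ unitary matrices all of whose entries lie in $\mathbb{Z}[1/2,i]=\{x_0+x_1 i\mid x_0,x_1\in\mathbb{Z}[1/2]\}$. Let $n\ge 4$. A matrix $V\in U_{2^n}(\mathbb{Z}[1/2,i])$ can be exactly represented by an ancilla-free $n$-qubit circuit over $\{X,CX,CCX,\omega H,S\}$ if and only if $\det V=1$. -/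

import Mathlib

open scoped Matrix

namespace GaussianCircuit

/-- The ring `𝔻 = ℤ[1/2]` of dyadic fractions `u / 2 ^ q`, as a subring of `ℝ`. -/
def Dyadic : Subring ℝ where
  carrier := {x | ∃ (u : ℤ) (q : ℕ), x = (u : ℝ) / 2 ^ q}
  zero_mem' := ⟨0, 0, by simp⟩
  one_mem' := ⟨1, 0, by simp⟩
  add_mem' := by
    rintro _ _ ⟨u, q, rfl⟩ ⟨v, r, rfl⟩
    refine ⟨u * 2 ^ r + v * 2 ^ q, q + r, ?_⟩
    push_cast
    rw [pow_add]
    field_simp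
  mul_mem' := by
    rintro _ _ ⟨u, q, rfl⟩ ⟨v, r, rfl⟩
    refine ⟨u * v, q + r, ?_⟩
    push_cast
    rw [pow_add]
    field_simp
  neg_mem' := by
    rintro _ ⟨u, q, rfl⟩
    refine ⟨-u, q, ?_⟩
    push_cast
    ring

/-- The ring `𝔻[i] = ℤ[1/2, i]` of complex numbers `x₀ + x₁ i` with `x₀`, `x₁` dyadic. -/
def DyadicGaussian : Subring ℂ where
  carrier := {z | ∃ x₀ ∈ Dyadic, ∃ x₁ ∈ Dyadic, z = (x₀ : ℂ) + (x₁ : ℂ) * Complex.I}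
  zero_mem' := ⟨0, Dyadic.zero_mem, 0, Dyadic.zero_mem, by simp⟩
  one_mem' := ⟨1, Dyadic.one_mem, 0, Dyadic.zero_mem, by simp⟩
  add_mem' := by
    rintro _ _ ⟨a, ha, b, hb, rfl⟩ ⟨c, hc, d, hd, rfl⟩
    refine ⟨a + c, Dyadic.add_mem ha hc, b + d, Dyadic.add_mem hb hd, ?_⟩
    push_cast
    ring
  mul_mem' := by
    rintro _ _ ⟨a, ha, b, hb, rfl⟩ ⟨c, hc, d, hd, rfl⟩
    refine ⟨a * c - b * d, Dyadic.sub_mem (Dyadic.mul_mem ha hc) (Dyadic.mul_mem hb hd),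
      a * d + b * c, Dyadic.add_mem (Dyadic.mul_mem ha hd) (Dyadic.mul_mem hb hc), ?_⟩
    push_cast
    linear_combination (b * d : ℂ) * Complex.I_mul_I
  neg_mem' := by
    rintro _ ⟨a, ha, b, hb, rfl⟩
    refine ⟨-a, Dyadic.neg_mem ha, -b, Dyadic.neg_mem hb, ?_⟩
    push_cast
    ring

/-- The labels of the `2 ^ n` computational basis states `|x₀ x₁ … xₙ₋₁⟩` of `n` qubits. -/
abbrev Basis (n : ℕ) : Type := Fin n → Fin 2

/-- Complex `2 ^ n × 2 ^ n` matrices, with rows and columns labelled by the computational basis. -/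
abbrev QMatrix (n : ℕ) : Type := Matrix (Basis n) (Basis n) ℂ

/-- `U_{2^n}(ℤ[1/2, i])`: the unitary `2 ^ n × 2 ^ n` matrices with all entries in `ℤ[1/2, i]`. -/
def unitaryDyadicGaussian (n : ℕ) : Set (QMatrix n) :=
  {V | V ∈ Matrix.unitaryGroup (Basis n) ℂ ∧ ∀ x y, V x y ∈ DyadicGaussian}

/-- The primitive eighth root of unity `ω = e^{iπ/4}`. -/
noncomputable def omega : ℂ := Complex.exp (Complex.I * (Real.pi / 4))

/-- A `2 × 2` matrix, as a matrix on one qubit. -/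
def oneQubit (M : Matrix (Fin 2) (Fin 2) ℂ) : QMatrix 1 :=
  Matrix.of fun x y => M (x 0) (y 0)

/-- The controlled matrix `I ⊕ U`; the control is the first qubit. -/
def controlled {k : ℕ} (U : QMatrix k) : QMatrix (k + 1) :=
  Matrix.of fun x y =>
    if x 0 = y 0 then
      if x 0 = 0 then (1 : QMatrix k) (Fin.tail x) (Fin.tail y) else U (Fin.tail x) (Fin.tail y)
    else 0

/-- The NOT gate `X`. -/
def matX : Matrix (Fin 2) (Fin 2) ℂ := !![0, 1; 1, 0]

/-- The Hadamard gate `H`. -/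
noncomputable def matH : Matrix (Fin 2) (Fin 2) ℂ := ((1 : ℂ) / (√2 : ℝ)) • !![1, 1; 1, -1]

/-- The phase gate `S`. -/
noncomputable def matS : Matrix (Fin 2) (Fin 2) ℂ := !![1, 0; 0, Complex.I]

/-- The names of the gates of the set `{X, CX, CCX, ωH, S}`. -/
inductive Gate : Type where
  | X
  | CX
  | CCX
  | omegaH
  | S

/-- The number of qubits on which a gate acts. -/
def Gate.arity : Gate → ℕ
  | .X => 1
  | .CX => 2
  | .CCX => 3
  | .omegaH => 1
  | .S => 1

/-- The matrix of a gate. -/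
noncomputable def Gate.matrix : (g : Gate) → QMatrix g.arity
  | .X => oneQubit matX
  | .CX => controlled (oneQubit matX)
  | .CCX => controlled (controlled (oneQubit matX))
  | .omegaH => oneQubit (omega • matH)
  | .S => oneQubit matS

/-- The matrix on `n` qubits that acts as `U` on the distinct qubits `f 0, …, f (k - 1)`, in this
order, and as the identity on all the other qubits (that is, `U ⊗ I` up to the order of the
tensor factors). -/
def onQubits {k n : ℕ} (f : Fin k ↪ Fin n) (U : QMatrix k) : QMatrix n :=
  open Classical in
  Matrix.of fun x y =>
    if ∀ j, j ∉ Set.range f → x j = y j then U (fun a => x (f a)) (fun a => y (f a)) else 0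

/-- A gate of the gate set, together with the distinct qubits (out of `n`) to which it is applied. -/
structure PlacedGate (n : ℕ) : Type where
  /-- the gate -/
  gate : Gate
  /-- the qubits to which it is applied, in order -/
  wires : Fin gate.arity ↪ Fin n

/-- An ancilla-free `n`-qubit circuit over `{X, CX, CCX, ωH, S}`: a finite sequence of gates applied
to some of the `n` qubits, in the order of time. There are no qubits other than the `n` inputs. -/
abbrev Circuit (n : ℕ) : Type := List (PlacedGate n)

/-- The matrix of a circuit; the gate that is applied first is the rightmost factor. -/
noncomputable def Circuit.matrix {n : ℕ} : Circuit n → QMatrix n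
  | [] => 1
  | p :: C => Circuit.matrix C * onQubits p.wires p.gate.matrix

/-- `V` is exactly represented by some ancilla-free circuit `C`: `C |ψ⟩ = V |ψ⟩` for every `n`-qubit
state `|ψ⟩`, which is the equality of the two matrices (global phases included). -/
def IsAncillaFreeRepresentable {n : ℕ} (V : QMatrix n) : Prop :=
  ∃ C : Circuit n, Circuit.matrix C = V

end GaussianCircuit

open scoped Matrix

set_option linter.unusedSectionVars false

namespace GaussianCircuit

/-! ### Matrices supported on a few basis vectors: blocks, phases, and `ωH` -/

section Block

variable {ι κ : Type*} [DecidableEq ι]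

/-! A `k`-qubit gate `g` placed on `n` qubits is `g ⊗ 1`, with determinant `det g ^ 2 ^ (n - k)`.
For `n ≥ 4` every gate has an order dividing this exponent, so every circuit has determinant 1
(`det_circuit`).

Conversely, finiteness of the orders makes the represented matrices a group `G` (`circuitGroup`). It
remains to find enough elements in `G` and to show that they suffice.

Sufficiency (`mem_of_det_eq_one`) is a column-by-column reduction. Write a unit column as Gaussian
integers over `(1 + i) ^ k`. The norms of the numerators sum to `2 ^ k`, so for `k > 0` the odd
numerators cannot be just one. Two odd numerators agree modulo 2 up to a power of `i`, so a phase
followed by `K = ωH` on these two coordinates makes both divisible by `1 + i`. Repeating this lowers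
`k` to 0, where one unit entry is left. This uses only ratios of one-level phases `i`, and `K` on an
arbitrary pair of basis vectors, corrected to determinant 1 by a phase `i` on some third vector.
What remains is diagonal with entries powers of `i` and determinant 1, hence a product of phase
ratios.

For the supply of elements, `X`, `CX`, `CCX` give all even permutations: commutators build NOT gates
with `n - 2` controls, the commutator of two of these is a 3-cycle, and Jordan's theorem applies to
the 2-transitive action (`alternatingGroup_le`). Comparing `S` with its conjugate by a 3-cycle gives
the phase ratios (`phase_mul_inv_phase_mem`). Finally the identity `S (K S K⁻¹) S = K`, read
simultaneously in commuting `2 × 2` blocks, isolates a single two-level `K` (`mul_map_mem_of_conj`,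
`blockHom_unitaryK_mul_phase_mem`). -/

/-- The matrix whose columns are the standard basis vectors `e_{f i}`. -/
def embedCols (f : κ → ι) : Matrix ι κ ℂ := (1 : Matrix ι ι ℂ).submatrix id f

theorem embedCols_apply (f : κ → ι) (x : ι) (i : κ) :
    embedCols f x i = if x = f i then 1 else 0 := by
  simp [embedCols, Matrix.one_apply]

variable [Fintype ι]

theorem mul_embedCols (A : Matrix ι ι ℂ) (f : κ → ι) : A * embedCols f = A.submatrix id f := by
  ext x i
  simp [Matrix.mul_apply, embedCols_apply]

variable [Fintype κ] [DecidableEq κ]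

theorem conjTranspose_embedCols_mul_self (f : κ ↪ ι) : (embedCols f)ᴴ * embedCols f = 1 := by
  ext i j
  simp [Matrix.mul_apply, embedCols_apply, Matrix.one_apply, @eq_comm _ j i]

theorem conjTranspose_embedCols_mul_of_disjoint {κ' : Type*} (f : κ → ι) (g : κ' → ι)
    (h : ∀ i j, f i ≠ g j) : (embedCols f)ᴴ * embedCols g = 0 := by
  ext i j
  rw [Matrix.mul_apply]
  refine Finset.sum_eq_zero fun x _ => ?_
  by_cases hx : x = f i
  · simp [embedCols_apply, hx, h i j]
  · simp [embedCols_apply, hx]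

/-- The matrix acting as `A` on the basis vectors in the range of `f` and trivially on the other
basis vectors. -/
def blockMat (f : κ → ι) (A : Matrix κ κ ℂ) : Matrix ι ι ℂ :=
  1 + embedCols f * (A - 1) * (embedCols f)ᴴ

theorem blockMat_one (f : κ → ι) : blockMat f (1 : Matrix κ κ ℂ) = 1 := by
  simp [blockMat]

theorem blockMat_mul (f : κ ↪ ι) (A B : Matrix κ κ ℂ) :
    blockMat f (A * B) = blockMat f A * blockMat f B := by
  have h : embedCols f * (A - 1) * (embedCols f)ᴴ * (embedCols f * (B - 1) * (embedCols f)ᴴ)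
      = embedCols f * ((A - 1) * (B - 1)) * (embedCols f)ᴴ := by
    have := conjTranspose_embedCols_mul_self f
    simp only [Matrix.mul_assoc]
    rw [← Matrix.mul_assoc (embedCols f)ᴴ, this, Matrix.one_mul]
  simp only [blockMat]
  rw [add_mul, mul_add, mul_add, h, one_mul, one_mul, mul_one, add_assoc]
  congr 1
  rw [← Matrix.add_mul, ← Matrix.add_mul, ← Matrix.mul_add, ← Matrix.mul_add]
  congr 2
  noncomm_ring

theorem star_blockMat (f : κ → ι) (A : Matrix κ κ ℂ) :
    star (blockMat f A) = blockMat f (star A) := by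
  simp [blockMat, Matrix.star_eq_conjTranspose, Matrix.mul_assoc]

/-- `blockMat` as a homomorphism of unitary groups. -/
def blockHom (f : κ ↪ ι) : Matrix.unitaryGroup κ ℂ →* Matrix.unitaryGroup ι ℂ where
  toFun A := ⟨blockMat f A, by
    rw [Matrix.mem_unitaryGroup_iff, star_blockMat, ← blockMat_mul,
      Matrix.mem_unitaryGroup_iff.1 A.2, blockMat_one]⟩
  map_one' := Subtype.ext (blockMat_one f)
  map_mul' A B := Subtype.ext (blockMat_mul f A B)

@[simp]
theorem coe_blockHom (f : κ ↪ ι) (A : Matrix.unitaryGroup κ ℂ) :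
    (blockHom f A : Matrix ι ι ℂ) = blockMat f A := rfl

theorem commute_blockHom {κ' : Type*} [Fintype κ'] [DecidableEq κ'] (f : κ ↪ ι) (g : κ' ↪ ι)
    (h : ∀ i j, f i ≠ g j) (A : Matrix.unitaryGroup κ ℂ) (B : Matrix.unitaryGroup κ' ℂ) :
    Commute (blockHom f A) (blockHom g B) := by
  have h1 := conjTranspose_embedCols_mul_of_disjoint f g h
  have h2 := conjTranspose_embedCols_mul_of_disjoint g f fun i j => (h j i).symm
  have h3 : ∀ (M : Matrix κ κ ℂ) (N : Matrix κ' κ' ℂ),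
      embedCols f * M * (embedCols f)ᴴ * (embedCols g * N * (embedCols g)ᴴ) = 0 := by
    intro M N
    simp only [Matrix.mul_assoc]
    rw [← Matrix.mul_assoc (embedCols f)ᴴ, h1]
    simp
  have h4 : ∀ (M : Matrix κ κ ℂ) (N : Matrix κ' κ' ℂ),
      embedCols g * N * (embedCols g)ᴴ * (embedCols f * M * (embedCols f)ᴴ) = 0 := by
    intro M N
    simp only [Matrix.mul_assoc]
    rw [← Matrix.mul_assoc (embedCols g)ᴴ, h2]
    simp
  apply Subtype.ext
  change blockMat f A.1 * blockMat g B.1 = blockMat g B.1 * blockMat f A.1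
  simp only [blockMat]
  rw [add_mul, mul_add, mul_add, h3, add_mul (1 : Matrix ι ι ℂ), mul_add, mul_add, h4]
  simp only [one_mul, mul_one, add_zero]
  abel

/-- If `g` maps the span of the vectors in the range of `f` to the span of those in the range of
`f'` by the matrix `B`, then it conjugates block matrices accordingly. -/
theorem conj_blockHom (g : Matrix.unitaryGroup ι ℂ) (f f' : κ ↪ ι) (B A : Matrix.unitaryGroup κ ℂ)
    (h : g.1 * embedCols f = embedCols f' * B.1) :
    g * blockHom f A * g⁻¹ = blockHom f' (B * A * B⁻¹) := by
  have h' : (embedCols f)ᴴ * star g.1 = star B.1 * (embedCols f')ᴴ := by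
    have := congrArg Matrix.conjTranspose h
    simpa [Matrix.conjTranspose_mul, Matrix.star_eq_conjTranspose] using this
  have hg := Matrix.mem_unitaryGroup_iff.1 g.2
  have hB := Matrix.mem_unitaryGroup_iff.1 B.2
  apply Subtype.ext
  change g.1 * blockMat f A.1 * star g.1 = blockMat f' (B.1 * A.1 * star B.1)
  have e1 : g.1 * (embedCols f * (A.1 - 1) * (embedCols f)ᴴ) * star g.1
      = embedCols f' * (B.1 * (A.1 - 1) * star B.1) * (embedCols f')ᴴ := by
    calc _ = (g.1 * embedCols f) * (A.1 - 1) * ((embedCols f)ᴴ * star g.1) := by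
          simp only [Matrix.mul_assoc]
      _ = _ := by
          rw [h, h']
          simp only [Matrix.mul_assoc]
  simp only [blockMat]
  rw [mul_add, add_mul, mul_one, hg, e1, mul_sub, sub_mul, mul_one, hB]

theorem blockMat_mulVec_apply (f : κ ↪ ι) (A : Matrix κ κ ℂ) (v : ι → ℂ) (i : κ) :
    (blockMat f A *ᵥ v) (f i) = (A *ᵥ (v ∘ f)) i := by
  have h1 : (embedCols f)ᴴ *ᵥ v = v ∘ f := by
    ext j
    simp [Matrix.mulVec, dotProduct, embedCols_apply]
  have h2 : ∀ w : κ → ℂ, (embedCols f *ᵥ w) (f i) = w i := by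
    intro w
    simp [Matrix.mulVec, dotProduct, embedCols_apply]
  rw [blockMat, Matrix.add_mulVec, ← Matrix.mulVec_mulVec, ← Matrix.mulVec_mulVec, h1,
    Pi.add_apply, h2, Matrix.sub_mulVec]
  simp

theorem blockMat_mulVec_apply_of_notMem (f : κ → ι) (A : Matrix κ κ ℂ) (v : ι → ℂ) {x : ι}
    (hx : ∀ i, x ≠ f i) : (blockMat f A *ᵥ v) x = v x := by
  have h2 : ∀ w : κ → ℂ, (embedCols f *ᵥ w) x = 0 := by
    intro w
    simp [Matrix.mulVec, dotProduct, embedCols_apply, hx]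
  rw [blockMat, Matrix.add_mulVec, ← Matrix.mulVec_mulVec, ← Matrix.mulVec_mulVec,
    Pi.add_apply, h2]
  simp

theorem blockMat_apply_of_notMem (f : κ → ι) (A : Matrix κ κ ℂ) (x : ι) {y : ι}
    (hy : ∀ i, y ≠ f i) : blockMat f A x y = (1 : Matrix ι ι ℂ) x y := by
  simp [blockMat, Matrix.mul_apply (M := embedCols f * (A - 1)), embedCols_apply, hy]

/-- Diagonal matrices with entries in the unit circle. -/
def diagHom : (ι → unitary ℂ) →* Matrix.unitaryGroup ι ℂ where
  toFun φ := ⟨Matrix.diagonal fun x => (φ x : ℂ), by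
    rw [Matrix.mem_unitaryGroup_iff, Matrix.star_eq_conjTranspose, Matrix.diagonal_conjTranspose,
      Matrix.diagonal_mul_diagonal, ← Matrix.diagonal_one]
    congr 1
    ext x
    exact Unitary.mul_star_self_of_mem (φ x).2⟩
  map_one' := Subtype.ext (by simp)
  map_mul' φ ψ := Subtype.ext (by simp [Matrix.diagonal_mul_diagonal])

@[simp]
theorem coe_diagHom (φ : ι → unitary ℂ) :
    (diagHom φ : Matrix ι ι ℂ) = Matrix.diagonal fun x => (φ x : ℂ) := rfl

/-- The imaginary unit, as a unitary element. -/
def unitI : unitary ℂ := ⟨Complex.I, by simp [Unitary.mem_iff]⟩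

@[simp]
theorem coe_unitI : (unitI : ℂ) = Complex.I := rfl

theorem unitI_pow_four : unitI ^ 4 = 1 := Subtype.ext (by simp)

/-- The one-level matrix multiplying the basis vector `e_c` by `i`. -/
def phase (c : ι) : Matrix.unitaryGroup ι ℂ := diagHom (Pi.mulSingle c unitI)

theorem phase_pow (c : ι) (m : ℕ) : phase c ^ m = diagHom (Pi.mulSingle c (unitI ^ m)) := by
  rw [phase, ← map_pow, Pi.mulSingle_pow]

theorem phase_pow_four (c : ι) : phase c ^ 4 = 1 := by
  rw [phase_pow, unitI_pow_four, Pi.mulSingle_one, map_one]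

theorem commute_phase (a b : ι) : Commute (phase a) (phase b) :=
  (Commute.all _ _).map diagHom

theorem phase_pow_mulVec (c : ι) (m : ℕ) (v : ι → ℂ) (x : ι) :
    ((phase c ^ m).1 *ᵥ v) x = (if x = c then Complex.I ^ m else 1) * v x := by
  rw [phase_pow]
  by_cases h : x = c
  · subst h; simp [Matrix.mulVec_diagonal]
  · simp [Matrix.mulVec_diagonal, h]

/-- The gate `ωH`, as a unitary matrix. -/
noncomputable def unitaryK : Matrix.unitaryGroup (Fin 2) ℂ :=
  ⟨!![(1 + Complex.I) / 2, (1 + Complex.I) / 2; (1 + Complex.I) / 2, -((1 + Complex.I) / 2)], by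
    rw [Matrix.mem_unitaryGroup_iff]
    ext i j
    fin_cases i <;> fin_cases j <;>
      simp [Matrix.mul_apply, Fin.sum_univ_two, map_ofNat] <;>
      linear_combination (-1 / 2 : ℂ) * Complex.I_mul_I⟩

/-- The embedding of `Fin 2` with values `a` and `b`. -/
def pairEmb {a b : ι} (h : a ≠ b) : Fin 2 ↪ ι :=
  ⟨![a, b], by
    intro i j
    fin_cases i <;> fin_cases j <;> simp [h, h.symm]⟩

@[simp]
theorem pairEmb_zero {a b : ι} (h : a ≠ b) : pairEmb h 0 = a := rfl

@[simp]
theorem pairEmb_one {a b : ι} (h : a ≠ b) : pairEmb h 1 = b := rfl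

end Block

/-! ### Parity of Gaussian integers and denominators in `ℤ[1/2, i]` -/

open GaussianInt

/-- The Gaussian integer `u` is divisible by `1 + i` exactly when its norm is even. -/
theorem exists_eq_mul_iff_even_norm (u : GaussianInt) :
    (∃ w : GaussianInt, (u : ℂ) = (1 + Complex.I) * (w : ℂ)) ↔ Even u.norm := by
  have hγ : (1 + Complex.I : ℂ) = ((⟨1, 1⟩ : GaussianInt) : ℂ) := by simp [toComplex_def]
  simp only [hγ, ← toComplex_mul, toComplex_inj]
  constructor
  · rintro ⟨w, rfl⟩
    rw [Zsqrtd.norm_mul]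
    exact Even.mul_right (by decide) _
  · intro h
    have h' : Even (u.re + u.im) := by
      rw [Zsqrtd.norm_def] at h
      have e : u.re * u.re - -1 * u.im * u.im = u.re * u.re + u.im * u.im := by ring
      rw [e] at h
      simpa [Int.even_add, Int.even_mul] using h
    obtain ⟨r, hr⟩ := h'
    -- The quotient is `u (1 - i) / 2`, with real part `(u.re + u.im) / 2 = r` and imaginary part
    -- `(u.im - u.re) / 2 = r - u.re`.
    refine ⟨⟨r, r - u.re⟩, ?_⟩
    ext
    · simp
    · simp; linarith

/-- An odd Gaussian integer is congruent to `1` or `i` modulo 2, and multiplication by `i` exchanges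
the two classes; so `m` can be taken to be 0 or 1. This is the arithmetic that lets `ωH` reduce a
denominator. -/
theorem exists_pow_add_sub_eq_two_mul {u w : GaussianInt} (hu : ¬ Even u.norm)
    (hw : ¬ Even w.norm) : ∃ (m : ℕ) (s t : GaussianInt),
      (u : ℂ) + Complex.I ^ m * w = 2 * s ∧ (u : ℂ) - Complex.I ^ m * w = 2 * t := by
  have key : ∀ u w : GaussianInt, Even (u.re + w.re) → Even (u.im + w.im) →
      ∃ s t : GaussianInt, (u : ℂ) + w = 2 * s ∧ (u : ℂ) - w = 2 * t := by
    rintro u w ⟨r, hr⟩ ⟨q, hq⟩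
    have hr' : (u.re + w.re : ℂ) = r + r := by exact_mod_cast hr
    have hq' : (u.im + w.im : ℂ) = q + q := by exact_mod_cast hq
    refine ⟨⟨r, q⟩, ⟨r - w.re, q - w.im⟩, ?_, ?_⟩
    · simp only [toComplex_def]
      linear_combination hr' + hq' * Complex.I
    · simp only [toComplex_def]
      push_cast
      linear_combination hr' + hq' * Complex.I
  have par : ∀ u : GaussianInt, ¬ Even u.norm → ¬ Even (u.re + u.im) := by
    intro u h h'
    apply h
    rw [Zsqrtd.norm_def]
    have e : u.re * u.re - -1 * u.im * u.im = u.re * u.re + u.im * u.im := by ring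
    rw [e]
    simpa [Int.even_add, Int.even_mul] using h'
  have hu' := par u hu
  have hw' := par w hw
  rw [Int.even_add] at hu' hw'
  by_cases h : Even (u.re + w.re)
  · obtain ⟨s, t, h1, h2⟩ := key u w h (by rw [Int.even_add] at h ⊢; tauto)
    exact ⟨0, s, t, by simpa using h1, by simpa using h2⟩
  · have hI : Complex.I * (w : ℂ) = ((⟨-w.im, w.re⟩ : GaussianInt) : ℂ) := by
      simp only [toComplex_def]
      push_cast
      linear_combination (w.im : ℂ) * Complex.I_mul_I
    obtain ⟨s, t, h1, h2⟩ := key u ⟨-w.im, w.re⟩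
      (by rw [Int.even_add] at h ⊢; rw [even_neg]; tauto) (by rw [Int.even_add] at h ⊢; tauto)
    exact ⟨1, s, t, by rw [pow_one, hI, h1], by rw [pow_one, hI, h2]⟩

theorem normSq_one_add_I : Complex.normSq (1 + Complex.I) = 2 := by
  simp [Complex.normSq_apply]; norm_num

theorem I_pow_mem (j : ℕ) : ∃ w : GaussianInt, Complex.I ^ j = w :=
  ⟨⟨0, 1⟩ ^ j, by rw [map_pow]; simp [toComplex_def]⟩

/-- A complex number of modulus one in `ℤ[1/2, i]` is a power of `i`. -/
theorem exists_eq_I_pow {z : ℂ} (hz : Complex.normSq z = 1) (k : ℕ) :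
    ∀ u : GaussianInt, (1 + Complex.I) ^ k * z = u → ∃ m : ℕ, z = Complex.I ^ m := by
  induction k with
  | zero =>
    intro u hu
    rw [pow_zero, one_mul] at hu
    subst hu
    rw [← intCast_real_norm] at hz
    have hz' : u.norm = 1 := by exact_mod_cast hz
    rw [Zsqrtd.norm_def] at hz'
    have h1 : u.re ≤ 1 := by nlinarith [mul_self_nonneg u.im]
    have h2 : -1 ≤ u.re := by nlinarith [mul_self_nonneg u.im]
    have h3 : u.im ≤ 1 := by nlinarith [mul_self_nonneg u.re]
    have h4 : -1 ≤ u.im := by nlinarith [mul_self_nonneg u.re]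
    obtain ⟨a, b⟩ := u
    simp only at *
    interval_cases a <;> interval_cases b <;> simp at hz'
    · exact ⟨2, by simp [toComplex_def]⟩
    · exact ⟨3, by simp [toComplex_def]⟩
    · exact ⟨1, by simp [toComplex_def]⟩
    · exact ⟨0, by simp [toComplex_def]⟩
  | succ k ih =>
    intro u hu
    -- As `z` has modulus one, the numerator has even norm and one factor `1 + i` cancels.
    have hn : u.norm = 2 ^ (k + 1) := by
      have := congrArg Complex.normSq hu
      rw [map_mul, map_pow, normSq_one_add_I, hz, ← intCast_real_norm] at this
      have h' : ((2 ^ (k + 1) : ℤ) : ℝ) = (u.norm : ℝ) := by push_cast; linarith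
      exact_mod_cast h'.symm
    obtain ⟨w, hw⟩ := (exists_eq_mul_iff_even_norm u).2
      (by rw [hn, pow_succ]; exact even_two.mul_left _)
    refine ih w ?_
    have h0 : (1 + Complex.I : ℂ) ≠ 0 := by
      intro h; have := normSq_one_add_I; rw [h] at this; simp at this
    apply mul_left_cancel₀ h0
    rw [← hw, ← hu]; ring

/-- Since `(1 + i) ^ 2 = 2 i`, powers of `1 + i` clear dyadic denominators. All large exponents are
covered so that finitely many entries can share one. -/
theorem exists_pow_mul_eq_gaussianInt {z : ℂ} (hz : z ∈ DyadicGaussian) :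
    ∃ k : ℕ, ∀ l ≥ k, ∃ u : GaussianInt, (1 + Complex.I) ^ l * z = u := by
  obtain ⟨_, ⟨u, q, rfl⟩, _, ⟨v, r, rfl⟩, rfl⟩ := hz
  refine ⟨2 * (q + r), fun l hl => ?_⟩
  obtain ⟨d, rfl⟩ := Nat.exists_eq_add_of_le hl
  refine ⟨⟨1, 1⟩ ^ d * ⟨0, 1⟩ ^ (q + r) * ⟨u * 2 ^ r, v * 2 ^ q⟩, ?_⟩
  have h2 : (1 + Complex.I) ^ 2 = Complex.I * 2 := by
    linear_combination Complex.I_mul_I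
  rw [pow_add, pow_mul, h2, mul_pow]
  simp only [toComplex_mul, map_pow]
  have e1 : ((⟨1, 1⟩ : GaussianInt) : ℂ) = 1 + Complex.I := by simp [toComplex_def]
  have e2 : ((⟨0, 1⟩ : GaussianInt) : ℂ) = Complex.I := by simp [toComplex_def]
  rw [e1, e2, toComplex_def]
  push_cast
  rw [pow_add 2]
  field_simp

/-! ### Two-level operations available in the group -/

section Descent

variable {ι : Type*} [Fintype ι] [DecidableEq ι]

theorem sum_normSq_mulVec (g : Matrix.unitaryGroup ι ℂ) (v : ι → ℂ) :
    ∑ x, Complex.normSq ((g.1 *ᵥ v) x) = ∑ x, Complex.normSq (v x) := by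
  have h : ∀ w : ι → ℂ, ((∑ x, Complex.normSq (w x) : ℝ) : ℂ) = star w ⬝ᵥ w := by
    intro w
    simp [dotProduct, Complex.normSq_eq_conj_mul_self]
  have h' : star (g.1 *ᵥ v) ⬝ᵥ (g.1 *ᵥ v) = star v ⬝ᵥ v := by
    rw [Matrix.star_mulVec, ← Matrix.dotProduct_mulVec, Matrix.mulVec_mulVec,
      ← Matrix.star_eq_conjTranspose, Matrix.mem_unitaryGroup_iff'.1 g.2, Matrix.one_mulVec]
  rw [← h, ← h] at h'
  exact_mod_cast h'

/-- Columns of `A` with index in `F` are multiples of the corresponding basis vectors. -/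
def DiagOn (F : Finset ι) (A : Matrix ι ι ℂ) : Prop :=
  ∀ y ∈ F, ∀ x ≠ y, A x y = 0

theorem DiagOn.one (F : Finset ι) : DiagOn F (1 : Matrix ι ι ℂ) :=
  fun _ _ _ h => Matrix.one_apply_ne h

theorem DiagOn.mul {F : Finset ι} {A B : Matrix ι ι ℂ} (hA : DiagOn F A) (hB : DiagOn F B) :
    DiagOn F (A * B) := by
  intro y hy x hx
  rw [Matrix.mul_apply]
  refine Finset.sum_eq_zero fun z _ => ?_
  by_cases hz : z = y
  · rw [hz, hA y hy x hx, zero_mul]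
  · rw [hB y hy z hz, mul_zero]

variable {G : Subgroup (Matrix.unitaryGroup ι ℂ)}

/-- The basic reduction step. Phases on a third vector `c` are unavoidable in determinant 1, and `c`
may lie among the columns already treated; this is why `DiagOn` asks these columns only to be
diagonal, not to be those of the identity. -/
theorem exists_twoLevel_mem (h1 : ∀ a b, phase a * (phase b)⁻¹ ∈ G)
    (h2 : ∀ a b (h : a ≠ b), ∃ c, c ≠ a ∧ c ≠ b ∧
      blockHom (pairEmb h) unitaryK * phase c ∈ G) {a b : ι} (hab : a ≠ b) (m : ℕ) :
    ∃ h ∈ G, (∀ F : Finset ι, a ∉ F → b ∉ F → DiagOn F h.1) ∧ ∀ v : ι → ℂ,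
      (h.1 *ᵥ v) a = (1 + Complex.I) / 2 * (v a + Complex.I ^ m * v b) ∧
      (h.1 *ᵥ v) b = (1 + Complex.I) / 2 * (v a - Complex.I ^ m * v b) ∧
      ∀ x, x ≠ a → x ≠ b → ∃ j : ℕ, (h.1 *ᵥ v) x = Complex.I ^ j * v x := by
  obtain ⟨c, hca, hcb, hc⟩ := h2 a b hab
  have hinv : (phase c)⁻¹ = phase c ^ 3 :=
    inv_eq_of_mul_eq_one_right (by rw [← pow_succ', phase_pow_four])
  -- The factor `(phase b * (phase c)⁻¹) ^ m` inserts `i ^ m` at `b` before `ωH` acts; only powers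
  -- of `i` accumulate at `c`.
  refine ⟨_, G.mul_mem hc (G.pow_mem (h1 b c) m), ?_, ?_⟩
  · intro F ha hb
    have hB : DiagOn F (blockHom (pairEmb hab) unitaryK).1 := by
      intro y hy x hx
      rw [coe_blockHom, blockMat_apply_of_notMem, Matrix.one_apply_ne hx]
      intro i
      fin_cases i
      · rintro rfl; exact ha hy
      · rintro rfl; exact hb hy
    have hd : ∀ φ : ι → unitary ℂ, DiagOn F (diagHom φ).1 :=
      fun φ y _ x hx => Matrix.diagonal_apply_ne _ hx
    rw [phase, phase, ← map_inv, ← map_mul, ← map_pow]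
    exact (hB.mul (hd _)).mul (hd _)
  · intro v
    have e : blockHom (pairEmb hab) unitaryK * phase c * (phase b * (phase c)⁻¹) ^ m
        = blockHom (pairEmb hab) unitaryK * (phase b ^ m * phase c ^ (3 * m + 1)) := by
      rw [hinv, ((commute_phase b c).pow_right 3).mul_pow, mul_assoc, ← mul_assoc (phase c),
        ← ((commute_phase b c).pow_left m).eq, ← pow_mul, mul_assoc (phase b ^ m), pow_succ' _ (3 * m)]
    rw [e]
    simp only [Submonoid.coe_mul, ← Matrix.mulVec_mulVec]
    set w : ι → ℂ := (phase b ^ m).1 *ᵥ ((phase c ^ (3 * m + 1)).1 *ᵥ v) with hw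
    have hwx : ∀ x, w x = (if x = b then Complex.I ^ m else 1) *
        ((if x = c then Complex.I ^ (3 * m + 1) else 1) * v x) := by
      intro x
      rw [hw, phase_pow_mulVec, phase_pow_mulVec]
    have hwa : w a = v a := by rw [hwx, if_neg hab, if_neg hca.symm, one_mul, one_mul]
    have hwb : w b = Complex.I ^ m * v b := by rw [hwx, if_pos rfl, if_neg hcb.symm, one_mul]
    refine ⟨?_, ?_, ?_⟩
    · have := blockMat_mulVec_apply (pairEmb hab) unitaryK.1 w 0
      rw [coe_blockHom]
      refine this.trans ?_
      simp [unitaryK, Matrix.mulVec, dotProduct, Fin.sum_univ_two, hwa, hwb]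
      ring
    · have := blockMat_mulVec_apply (pairEmb hab) unitaryK.1 w 1
      rw [coe_blockHom]
      refine this.trans ?_
      simp [unitaryK, Matrix.mulVec, dotProduct, Fin.sum_univ_two, hwa, hwb]
      ring
    · intro x hxa hxb
      rw [coe_blockHom, blockMat_mulVec_apply_of_notMem, hwx, if_neg hxb, one_mul]
      · by_cases hxc : x = c
        · exact ⟨_, by rw [if_pos hxc]⟩
        · exact ⟨0, by rw [if_neg hxc, pow_zero]⟩
      · intro i
        fin_cases i
        · exact hxa
        · exact hxb

end Descent

/-! ### Exact synthesis by column reduction -/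

section Synthesis

variable {ι : Type*} [Fintype ι] [DecidableEq ι] {G : Subgroup (Matrix.unitaryGroup ι ℂ)}

theorem exists_single_of_sum_norm_eq_one (u : ι → GaussianInt) (h : ∑ x, (u x).norm = 1) :
    ∃ j, u j ≠ 0 ∧ ∀ x ≠ j, u x = 0 := by
  obtain ⟨j, hj⟩ : ∃ j, u j ≠ 0 := by
    by_contra! hu
    simp [hu] at h
  refine ⟨j, hj, fun x hx => ?_⟩
  rw [← Finset.add_sum_erase _ _ (Finset.mem_univ j)] at h
  have h1 := norm_pos.2 hj
  have h2 : ∑ x ∈ Finset.univ.erase j, (u x).norm = 0 :=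
    le_antisymm (by linarith) (Finset.sum_nonneg fun x _ => GaussianInt.norm_nonneg _)
  have := (Finset.sum_eq_zero_iff_of_nonneg fun x _ => GaussianInt.norm_nonneg _).1 h2 x
    (Finset.mem_erase.2 ⟨hx, Finset.mem_univ x⟩)
  exact GaussianInt.norm_eq_zero.1 this

theorem exists_ne_of_even_sum (u : ι → GaussianInt) (h : Even (∑ x, (u x).norm)) {a : ι}
    (ha : ¬ Even (u a).norm) : ∃ b ≠ a, ¬ Even (u b).norm := by
  by_contra! hb
  rw [← Finset.add_sum_erase _ _ (Finset.mem_univ a), Int.even_add] at h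
  refine ha (h.2 ?_)
  exact Finset.even_sum _ fun x hx => hb x (Finset.ne_of_mem_erase hx)

/-- A unit vector over `ℤ[1/2, i]` can be moved into a coordinate axis. -/
theorem exists_mem_mulVec_single (h1 : ∀ a b, phase a * (phase b)⁻¹ ∈ G)
    (h2 : ∀ a b (h : a ≠ b), ∃ c, c ≠ a ∧ c ≠ b ∧
      blockHom (pairEmb h) unitaryK * phase c ∈ G) (F : Finset ι) (k : ℕ) :
    ∀ v : ι → ℂ, (∀ x ∈ F, v x = 0) → ∑ x, Complex.normSq (v x) = 1 →
      (∀ x, ∃ u : GaussianInt, (1 + Complex.I) ^ k * v x = u) →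
      ∃ h ∈ G, DiagOn F h.1 ∧ ∃ j ∉ F, ∀ x ≠ j, (h.1 *ᵥ v) x = 0 := by
  have h0 : (1 + Complex.I : ℂ) ≠ 0 := by
    intro h; have := normSq_one_add_I; rw [h] at this; simp at this
  have hsum : ∀ (k : ℕ) (v : ι → ℂ) (u : ι → GaussianInt), ∑ x, Complex.normSq (v x) = 1 →
      (∀ x, (1 + Complex.I) ^ k * v x = u x) → ∑ x, (u x).norm = 2 ^ k := by
    intro k v u hv hu
    have : ((∑ x, (u x).norm : ℤ) : ℝ) = ((2 ^ k : ℤ) : ℝ) := by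
      push_cast
      simp_rw [intCast_real_norm, ← hu, map_mul, map_pow, normSq_one_add_I]
      rw [← Finset.mul_sum, hv, mul_one]
    exact_mod_cast this
  induction k with
  | zero =>
    intro v hF hv hu
    choose u hu using hu
    obtain ⟨j, hj, hx⟩ := exists_single_of_sum_norm_eq_one u (by simpa using hsum 0 v u hv hu)
    refine ⟨1, G.one_mem, DiagOn.one F, j, ?_, fun x hxj => ?_⟩
    · intro hjF
      have := hu j
      rw [hF j hjF, mul_zero, eq_comm, toComplex_eq_zero] at this
      exact hj this
    · have := hu x
      rw [hx x hxj] at this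
      simpa using this
  | succ k ih =>
    -- Inner induction on the number of odd numerators; when none is left, a factor `1 + i` cancels
    -- everywhere and the outer induction on `k` takes over.
    suffices H : ∀ (N : ℕ) (v : ι → ℂ) (u : ι → GaussianInt), (∀ x ∈ F, v x = 0) →
        ∑ x, Complex.normSq (v x) = 1 → (∀ x, (1 + Complex.I) ^ (k + 1) * v x = u x) →
        (Finset.univ.filter fun x => ¬ Even (u x).norm).card ≤ N →
        ∃ h ∈ G, DiagOn F h.1 ∧ ∃ j ∉ F, ∀ x ≠ j, (h.1 *ᵥ v) x = 0 by
      intro v hF hv hu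
      choose u hu using hu
      exact H _ v u hF hv hu le_rfl
    intro N
    induction N with
    | zero =>
      intro v u hF hv hu hN
      refine ih v hF hv fun x => ?_
      have hx : Even (u x).norm := by
        by_contra hx
        have : x ∈ Finset.univ.filter fun x => ¬ Even (u x).norm := by simpa using hx
        rw [Finset.card_eq_zero.1 (Nat.le_zero.1 hN)] at this
        simp at this
      obtain ⟨w, hw⟩ := (exists_eq_mul_iff_even_norm (u x)).2 hx
      refine ⟨w, mul_left_cancel₀ h0 ?_⟩
      rw [← hw, ← hu]; ring
    | succ N ihN =>
      intro v u hF hv hu hN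
      by_cases hodd : ∃ a, ¬ Even (u a).norm
      swap
      · push Not at hodd
        refine ihN v u hF hv hu ?_
        simp [hodd]
      obtain ⟨a, ha⟩ := hodd
      -- The norms sum to `2 ^ (k + 1)`, which is even, so an odd numerator has an odd partner.
      obtain ⟨b, hba, hb⟩ := exists_ne_of_even_sum u
        (by rw [hsum _ v u hv hu, pow_succ]; exact even_two.mul_left _) ha
      obtain ⟨m, s, t, hs, ht⟩ := exists_pow_add_sub_eq_two_mul ha hb
      obtain ⟨g, hgG, hgF, hg⟩ := exists_twoLevel_mem h1 h2 hba.symm m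
      obtain ⟨hga, hgb, hgx⟩ := hg v
      have hnotF : ∀ c, ¬ Even (u c).norm → c ∉ F := by
        intro c hc hcF
        have := hu c
        rw [hF c hcF, mul_zero, eq_comm, toComplex_eq_zero] at this
        exact hc (by simp [this])
      have hgF := hgF F (hnotF a ha) (hnotF b hb)
      have hxF : ∀ x ∈ F, (g.1 *ᵥ v) x = 0 := by
        intro x hx
        obtain ⟨j, hj⟩ := hgx x (fun h => hnotF a ha (h ▸ hx)) (fun h => hnotF b hb (h ▸ hx))
        rw [hj, hF x hx, mul_zero]
      have hnew : ∀ x, ∃ w : GaussianInt, (1 + Complex.I) ^ (k + 1) * (g.1 *ᵥ v) x = w ∧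
          (x = a ∨ x = b ∨ Even (u x).norm → Even w.norm) := by
        intro x
        by_cases hxa : x = a
        · subst hxa
          have e : (1 + Complex.I) ^ (k + 1) * (g.1 *ᵥ v) x
              = (1 + Complex.I) * (s : ℂ) := by
            rw [hga]
            linear_combination (1 + Complex.I) / 2 * (hs + hu x + Complex.I ^ m * hu b)
          refine ⟨⟨1, 1⟩ * s, by rw [e, toComplex_mul]; simp [toComplex_def ⟨1, 1⟩], fun _ => ?_⟩
          rw [Zsqrtd.norm_mul]
          exact Even.mul_right (by decide) _
        by_cases hxb : x = b
        · subst hxb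
          have e : (1 + Complex.I) ^ (k + 1) * (g.1 *ᵥ v) x
              = (1 + Complex.I) * (t : ℂ) := by
            rw [hgb]
            linear_combination (1 + Complex.I) / 2 * (ht + hu a - Complex.I ^ m * hu x)
          refine ⟨⟨1, 1⟩ * t, by rw [e, toComplex_mul]; simp [toComplex_def ⟨1, 1⟩], fun _ => ?_⟩
          rw [Zsqrtd.norm_mul]
          exact Even.mul_right (by decide) _
        obtain ⟨j, hj⟩ := hgx x hxa hxb
        obtain ⟨w, hw⟩ := I_pow_mem j
        refine ⟨w * u x, ?_, ?_⟩
        · rw [hj, toComplex_mul, ← hw, ← hu]; ring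
        · rintro (h | h | h)
          · exact absurd h hxa
          · exact absurd h hxb
          · rw [Zsqrtd.norm_mul]
            exact h.mul_left _
      choose u' hu' hev using hnew
      obtain ⟨h, hhG, hhF, j, hjF, hj⟩ := ihN (g.1 *ᵥ v) u' hxF
        (by rw [sum_normSq_mulVec, hv]) hu' (by
          -- No even numerator becomes odd, and `a` has left the odd set.
          have hlt : (Finset.univ.filter fun x => ¬ Even (u' x).norm) ⊂
              Finset.univ.filter fun x => ¬ Even (u x).norm := by
            rw [Finset.ssubset_iff_of_subset]
            · exact ⟨a, by simpa using ha, by simpa using hev a (Or.inl rfl)⟩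
            · intro x hx
              simp only [Finset.mem_filter, Finset.mem_univ, true_and] at hx ⊢
              exact fun hx' => hx (hev x (Or.inr (Or.inr hx')))
          have := Finset.card_lt_card hlt
          omega)
      refine ⟨h * g, G.mul_mem hhG hgG, hhF.mul hgF, j, hjF, fun x hx => ?_⟩
      rw [Submonoid.coe_mul, ← Matrix.mulVec_mulVec]
      exact hj x hx

/-- A two-level step with `m = 0` spreads the entry at `j` equally over `j` and `c`; a second one
with `m = 2`, where `i ^ 2 = -1`, cancels it at `j`. -/
theorem exists_mem_mulVec_single_at (h1 : ∀ a b, phase a * (phase b)⁻¹ ∈ G)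
    (h2 : ∀ a b (h : a ≠ b), ∃ c, c ≠ a ∧ c ≠ b ∧
      blockHom (pairEmb h) unitaryK * phase c ∈ G) (F : Finset ι) {j c : ι} (hj : j ∉ F)
    (hc : c ∉ F) (v : ι → ℂ) (hv : ∀ x ≠ j, v x = 0) :
    ∃ h ∈ G, DiagOn F h.1 ∧ ∀ x ≠ c, (h.1 *ᵥ v) x = 0 := by
  by_cases hjc : j = c
  · subst hjc
    exact ⟨1, G.one_mem, DiagOn.one F, fun x hx => by simpa using hv x hx⟩
  obtain ⟨g, hgG, hgF, hg⟩ := exists_twoLevel_mem h1 h2 hjc 0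
  obtain ⟨h, hhG, hhF, hh⟩ := exists_twoLevel_mem h1 h2 hjc 2
  obtain ⟨hga, hgb, hgx⟩ := hg v
  obtain ⟨hha, hhb, hhx⟩ := hh (g.1 *ᵥ v)
  refine ⟨h * g, G.mul_mem hhG hgG, (hhF F hj hc).mul (hgF F hj hc), fun x hx => ?_⟩
  rw [Submonoid.coe_mul, ← Matrix.mulVec_mulVec]
  by_cases hxj : x = j
  · rw [hxj, hha, hga, hgb, hv c (Ne.symm hjc), Complex.I_sq]
    ring
  · obtain ⟨m, hm⟩ := hhx x hxj hx
    obtain ⟨l, hl⟩ := hgx x hxj hx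
    rw [hm, hl, hv x hxj, mul_zero, mul_zero]

/-- The diagonal matrices of determinant one with powers of `i` on the diagonal lie in `G`. -/
theorem diagHom_mem_of_prod_eq_one (h1 : ∀ a b, phase a * (phase b)⁻¹ ∈ G) (φ : ι → unitary ℂ)
    (hφ : ∀ x, ∃ m : ℕ, φ x = unitI ^ m) (hprod : ∏ x, φ x = 1) : diagHom φ ∈ G := by
  rcases isEmpty_or_nonempty ι with hι | ⟨⟨a⟩⟩
  · rw [Subsingleton.elim φ 1, map_one]
    exact G.one_mem
  choose m hm using hφ
  -- Each entry is moved to the fixed position `a`; what collects there is the inverse of the total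
  -- product, which is 1.
  have key : φ = ∏ x, (Pi.mulSingle x (φ x) * (Pi.mulSingle a (φ x))⁻¹) := by
    rw [Finset.prod_mul_distrib, Finset.univ_prod_mulSingle, Finset.prod_inv_distrib]
    have : ∏ x, Pi.mulSingle (M := fun _ => unitary ℂ) a (φ x) = Pi.mulSingle a (∏ x, φ x) :=
      (map_prod (MonoidHom.mulSingle (fun _ : ι => unitary ℂ) a) _ _).symm
    rw [this, hprod, Pi.mulSingle_one, inv_one, mul_one]
  rw [key]
  refine Subgroup.prod_mem (G.comap diagHom) fun x _ => ?_
  have e : Pi.mulSingle x (φ x) * (Pi.mulSingle a (φ x))⁻¹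
      = (Pi.mulSingle x unitI * (Pi.mulSingle a unitI)⁻¹ : ι → unitary ℂ) ^ m x := by
    rw [mul_pow, inv_pow, ← Pi.mulSingle_pow, ← Pi.mulSingle_pow, hm]
  rw [e]
  refine Subgroup.pow_mem _ ?_ _
  rw [Subgroup.mem_comap, map_mul, map_inv]
  exact h1 x a

/-- Exact synthesis: a group of matrices of determinant one over `ℤ[1/2, i]` that contains enough
diagonal and two-level matrices contains all unitary matrices of determinant one over that ring. -/
theorem mem_of_det_eq_one (hdet : ∀ g ∈ G, g.1.det = 1)
    (hR : ∀ g ∈ G, ∀ x y, g.1 x y ∈ DyadicGaussian)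
    (h1 : ∀ a b, phase a * (phase b)⁻¹ ∈ G)
    (h2 : ∀ a b (h : a ≠ b), ∃ c, c ≠ a ∧ c ≠ b ∧
      blockHom (pairEmb h) unitaryK * phase c ∈ G)
    (V : Matrix.unitaryGroup ι ℂ) (hV : ∀ x y, V.1 x y ∈ DyadicGaussian) (hVdet : V.1.det = 1) :
    V ∈ G := by
  have hmul : ∀ g ∈ G, ∀ x y, (g * V).1 x y ∈ DyadicGaussian := by
    intro g hg x y
    rw [Submonoid.coe_mul, Matrix.mul_apply]
    exact sum_mem fun z _ => mul_mem (hR g hg x z) (hV z y)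
  have hunit : ∀ (U : Matrix.unitaryGroup ι ℂ) (c : ι), ∑ x, Complex.normSq (U.1 x c) = 1 := by
    intro U c
    have := sum_normSq_mulVec U (Pi.single c 1)
    rw [Matrix.mulVec_single_one] at this
    refine this.trans ?_
    rw [Finset.sum_eq_single c]
    · simp
    · intro x _ hx; simp [hx]
    · simp
  have hint : ∀ z : ι → ℂ, (∀ x, z x ∈ DyadicGaussian) →
      ∃ k : ℕ, ∀ x, ∃ u : GaussianInt, (1 + Complex.I) ^ k * z x = u := by
    intro z hz
    choose k hk using fun x => exists_pow_mul_eq_gaussianInt (hz x)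
    exact ⟨∑ x, k x, fun x => hk x _ (Finset.single_le_sum (f := k) (fun _ _ => Nat.zero_le _)
      (Finset.mem_univ x))⟩
  have main : ∀ F : Finset ι, ∃ g ∈ G, DiagOn F (g * V).1 := by
    intro F
    induction F using Finset.induction_on with
    | empty => exact ⟨1, G.one_mem, fun y hy => by simp at hy⟩
    | insert c F hc ih =>
      obtain ⟨g, hgG, hg⟩ := ih
      set v : ι → ℂ := fun x => (g * V).1 x c with hv
      -- The columns with index `y ∈ F` are nonzero multiples of `e_y`, so orthogonality of columns
      -- kills the entries of column `c` in `F`.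
      have hvF : ∀ x ∈ F, v x = 0 := by
        intro y hy
        have horth := Matrix.mem_unitaryGroup_iff'.1 (g * V).2
        have h' := congrFun (congrFun horth y) c
        rw [Matrix.mul_apply, Matrix.one_apply_ne (show y ≠ c by rintro rfl; exact hc hy),
          Finset.sum_eq_single y] at h'
        · rcases mul_eq_zero.1 h' with h' | h'
          · exfalso
            have h3 : (g * V).1 y y = 0 := by
              rw [Matrix.star_apply] at h'
              exact star_eq_zero.1 h'
            have := hunit (g * V) y
            rw [Finset.sum_eq_zero] at this
            · exact zero_ne_one this
            · intro x _
              by_cases hx : x = y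
              · rw [hx, h3, map_zero]
              · rw [hg y hy x hx, map_zero]
          · exact h'
        · intro x _ hx
          rw [Matrix.star_apply, hg y hy x hx, star_zero, zero_mul]
        · simp
      obtain ⟨k, hk⟩ := hint v (fun x => hmul g hgG x c)
      obtain ⟨h, hhG, hhF, j, hjF, hj⟩ :=
        exists_mem_mulVec_single h1 h2 F k v hvF (hunit (g * V) c) hk
      obtain ⟨h', hhG', hhF', hj'⟩ := exists_mem_mulVec_single_at h1 h2 F hjF hc (h.1 *ᵥ v) hj
      refine ⟨h' * h * g, G.mul_mem (G.mul_mem hhG' hhG) hgG, ?_⟩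
      have e : (h' * h * g * V).1 = h'.1 * h.1 * (g * V).1 := by
        simp only [Submonoid.coe_mul, Matrix.mul_assoc]
      rw [e]
      intro y hy x hx
      rcases Finset.mem_insert.1 hy with rfl | hy
      · have := hj' x hx
        rw [Matrix.mulVec_mulVec] at this
        exact this
      · exact ((hhF'.mul hhF).mul hg) y hy x hx
  obtain ⟨g, hgG, hg⟩ := main Finset.univ
  have hdiag : ∀ y x, x ≠ y → (g * V).1 x y = 0 := fun y x hx => hg y (Finset.mem_univ y) x hx
  have hone : ∀ x, Complex.normSq ((g * V).1 x x) = 1 := by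
    intro y
    rw [← hunit (g * V) y, Finset.sum_eq_single y]
    · intro x _ hx; rw [hdiag y x hx, map_zero]
    · simp
  have hpow : ∀ x, ∃ m : ℕ, (g * V).1 x x = Complex.I ^ m := by
    intro x
    obtain ⟨k, hk⟩ := exists_pow_mul_eq_gaussianInt (hmul g hgG x x)
    obtain ⟨u, hu⟩ := hk k le_rfl
    exact exists_eq_I_pow (hone x) k u hu
  choose m hm using hpow
  have e : g * V = diagHom fun x => unitI ^ m x := by
    apply Subtype.ext
    ext x y
    by_cases hxy : x = y
    · subst hxy; simp [hm]
    · rw [hdiag y x hxy, coe_diagHom, Matrix.diagonal_apply_ne _ hxy]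
  have hd : (g * V).1.det = 1 := by
    rw [Submonoid.coe_mul, Matrix.det_mul, hdet g hgG, hVdet, one_mul]
  have hgV : g * V ∈ G := by
    rw [e]
    refine diagHom_mem_of_prod_eq_one h1 _ (fun x => ⟨m x, rfl⟩) ?_
    apply Subtype.ext
    rw [e, coe_diagHom, Matrix.det_diagonal] at hd
    simpa using hd
  exact (G.mul_mem_cancel_left hgG).1 hgV

end Synthesis

/-! ### Even permutations of the basis from `X`, `CX`, `CCX` -/

section Permutations

open Equiv

/-- For involutions the product is the commutator. If the supports meet only in `a`, then `τ` fixes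
`σ a` and `σ` fixes `τ a`, and everything cancels outside `a`, `σ a`, `τ a`. -/
theorem isThreeCycle_of_involutive {α : Type*} [Fintype α] [DecidableEq α] {σ τ : Perm α}
    (hσ : ∀ x, σ (σ x) = x) (hτ : ∀ x, τ (τ x) = x) {a : α} (hσa : σ a ≠ a) (hτa : τ a ≠ a)
    (h : ∀ x, σ x ≠ x → τ x ≠ x → x = a) : (σ * τ * σ * τ).IsThreeCycle := by
  have hb : τ (σ a) = σ a := by
    by_contra hb
    exact hσa (h _ (by rw [hσ]; exact hσa.symm) hb)
  have hc : σ (τ a) = τ a := by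
    by_contra hc
    exact hτa (h _ hc (by rw [hτ]; exact hτa.symm))
  have hbc : σ a ≠ τ a := by
    intro e
    rw [← e, hσ] at hc
    exact hσa hc.symm
  have e : σ * τ * σ * τ = swap (σ a) a * swap (σ a) (τ a) := by
    ext x
    simp only [Perm.mul_apply]
    by_cases hxa : x = a
    · subst hxa
      rw [hc, hτ, swap_apply_of_ne_of_ne hσa.symm hτa.symm, swap_apply_right]
    by_cases hxb : x = σ a
    · subst hxb
      rw [hb, hσ, hc, swap_apply_left, swap_apply_of_ne_of_ne hbc.symm hτa]
    by_cases hxc : x = τ a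
    · subst hxc
      rw [hτ, hb, hσ, swap_apply_right, swap_apply_left]
    rw [swap_apply_of_ne_of_ne hxb hxc, swap_apply_of_ne_of_ne hxb hxa]
    by_cases h1 : τ x = x
    · rw [h1]
      by_cases h2 : σ x = x
      · rw [h2, h1, h2]
      · have h3 : τ (σ x) = σ x := by
          by_contra h3
          have := h _ (by rw [hσ]; exact fun h => h2 h.symm) h3
          exact hxb (by rw [← this, hσ])
        rw [h3, hσ]
    · have h3 : σ (τ x) = τ x := by
        by_contra h3
        have := h _ h3 (by rw [hτ]; exact fun h => h1 h.symm)
        exact hxc (by rw [← this, hτ])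
      have h2 : σ x = x := by
        by_contra h2
        exact hxa (h x h2 h1)
      rw [h3, hτ, h2]
  rw [e]
  exact Perm.isThreeCycle_swap_mul_swap_same hσa hbc hτa.symm

variable {n : ℕ}

theorem fin_two_add_one_add_one (a : Fin 2) : a + 1 + 1 = a := by
  revert a; decide

/-- The controlled NOT gate with target `t` and controls `C \ {t}`, as a permutation of the
computational basis. -/
def ctrlNot (C : Finset (Fin n)) (t : Fin n) : Perm (Basis n) :=
  Function.Involutive.toPerm
    (fun x => if ∀ c ∈ C, c ≠ t → x c = 1 then Function.update x t (x t + 1) else x) (by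
      intro x
      by_cases h : ∀ c ∈ C, c ≠ t → x c = 1
      · have h' : ∀ c ∈ C, c ≠ t → Function.update x t (x t + 1) c = 1 := by
          intro c hc hct
          rw [Function.update_of_ne hct, h c hc hct]
        simp only [if_pos h, if_pos h']
        simp [fin_two_add_one_add_one]
      · simp only [if_neg h])

theorem ctrlNot_ctrlNot (C : Finset (Fin n)) (t : Fin n) (x : Basis n) :
    ctrlNot C t (ctrlNot C t x) = x :=
  Function.Involutive.toPerm_involutive _ x

theorem ctrlNot_apply_of_ne (C : Finset (Fin n)) {t j : Fin n} (h : j ≠ t) (x : Basis n) :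
    ctrlNot C t x j = x j := by
  change (ite _ _ _ : Basis n) j = _
  split_ifs
  · rw [Function.update_of_ne h]
  · rfl

theorem ctrlNot_apply_self (C : Finset (Fin n)) (t : Fin n) (x : Basis n) :
    ctrlNot C t x t = if ∀ c ∈ C, c ≠ t → x c = 1 then x t + 1 else x t := by
  change (ite _ _ _ : Basis n) t = _
  split_ifs
  · rw [Function.update_self]
  · rfl

theorem ctrlNot_apply_ne_iff (C : Finset (Fin n)) (t : Fin n) (x : Basis n) :
    ctrlNot C t x ≠ x ↔ ∀ c ∈ C, c ≠ t → x c = 1 := by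
  constructor
  · intro h
    by_contra h'
    apply h
    ext1 j
    by_cases hj : j = t
    · rw [hj, ctrlNot_apply_self, if_neg h']
    · rw [ctrlNot_apply_of_ne C hj]
  · intro h h'
    have := congrFun h' t
    rw [ctrlNot_apply_self, if_pos h] at this
    revert this
    generalize x t = a
    revert a; decide

/-- Over `𝔽₂`, writing `α` for the conjunction of the bits in `A`, the target receives `x_c x_b +
x_c (x_b + α) = x_c α`, while `b` receives `α` twice and is restored. Thus `b` is a borrowed qubit
whose value is arbitrary. -/
theorem ctrlNot_commutator {A : Finset (Fin n)} {b c t : Fin n} (hbA : b ∉ A) (htA : t ∉ A)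
    (hbt : b ≠ t) (hcb : c ≠ b) (hct : c ≠ t) :
    ctrlNot A b * ctrlNot {c, b} t * ctrlNot A b * ctrlNot {c, b} t = ctrlNot (insert c A) t := by
  ext1 x
  simp only [Perm.mul_apply]
  set x1 := ctrlNot {c, b} t x with hx1
  set x2 := ctrlNot A b x1 with hx2
  set x3 := ctrlNot {c, b} t x2 with hx3
  have h1 : ∀ j, j ≠ t → x1 j = x j := fun j hj => ctrlNot_apply_of_ne _ hj x
  have h2 : ∀ j, j ≠ b → x2 j = x1 j := fun j hj => ctrlNot_apply_of_ne _ hj x1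
  have h3 : ∀ j, j ≠ t → x3 j = x2 j := fun j hj => ctrlNot_apply_of_ne _ hj x2
  have cA : ∀ y : Basis n, (∀ j ∈ A, y j = x j) →
      ((∀ a ∈ A, a ≠ b → y a = 1) ↔ ∀ a ∈ A, x a = 1) := by
    intro y hy
    refine forall₂_congr fun a ha => ?_
    rw [hy a ha]
    exact ⟨fun h => h fun h => hbA (h ▸ ha), fun h _ => h⟩
  have mA : ∀ j ∈ A, j ≠ b ∧ j ≠ t := fun j hj => ⟨fun h => hbA (h ▸ hj), fun h => htA (h ▸ hj)⟩
  have cc : ∀ y : Basis n, (∀ a ∈ ({c, b} : Finset (Fin n)), a ≠ t → y a = 1) ↔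
      y c = 1 ∧ y b = 1 := by
    intro y; simp [hbt, hct]
  have s1 : x1 t = if x c = 1 ∧ x b = 1 then x t + 1 else x t := by
    rw [hx1, ctrlNot_apply_self]; simp only [cc]
  have s2 : x2 b = if ∀ a ∈ A, x a = 1 then x b + 1 else x b := by
    rw [hx2, ctrlNot_apply_self, h1 b hbt]
    simp only [cA x1 fun j hj => h1 j (mA j hj).2]
  have s3 : x3 t = if x2 c = 1 ∧ x2 b = 1 then x2 t + 1 else x2 t := by
    rw [hx3, ctrlNot_apply_self]; simp only [cc]
  have s4 : ctrlNot A b x3 b = if ∀ a ∈ A, x a = 1 then x3 b + 1 else x3 b := by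
    rw [ctrlNot_apply_self]
    simp only [cA x3 fun j hj => by rw [h3 j (mA j hj).2, h2 j (mA j hj).1, h1 j (mA j hj).2]]
  ext1 j
  by_cases hjt : j = t
  · subst hjt
    have cC : (∀ a ∈ insert c A, a ≠ j → x a = 1) ↔ x c = 1 ∧ ∀ a ∈ A, x a = 1 := by
      rw [Finset.forall_mem_insert]
      refine and_congr ⟨fun h => h hct, fun h _ => h⟩ (forall₂_congr fun a ha => ?_)
      exact ⟨fun h => h (mA a ha).2, fun h _ => h⟩
    rw [ctrlNot_apply_of_ne _ hbt.symm, s3, s2, h2 c hcb, h1 c hct, h2 j hbt.symm, s1,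
      ctrlNot_apply_self]
    simp only [cC]
    by_cases hA : ∀ a ∈ A, x a = 1
    · simp only [eq_true hA, and_true, if_true]
      generalize x c = p, x b = q, x j = r
      revert p q r
      decide
    · simp only [hA, and_false]
      generalize x c = p, x b = q, x j = r
      revert p q r
      decide
  · rw [ctrlNot_apply_of_ne _ hjt]
    by_cases hjb : j = b
    · subst hjb
      rw [s4, h3 j hjt, s2]
      split_ifs
      · rw [fin_two_add_one_add_one]
      · rfl
    · rw [ctrlNot_apply_of_ne _ hjb, h3 j hjt, h2 j hjb, h1 j hjt]

variable {Q : Subgroup (Perm (Basis n))}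

/-- Controlled NOT gates with a spare qubit are obtained from those with at most two controls. -/
theorem ctrlNot_mem (hQ : ∀ C t, C.card ≤ 2 → t ∉ C → ctrlNot C t ∈ Q) (k : ℕ) :
    ∀ (C : Finset (Fin n)) (t : Fin n), C.card = k → C.card + 2 ≤ n → t ∉ C → ctrlNot C t ∈ Q := by
  induction k using Nat.strong_induction_on with
  | _ k ih =>
    intro C t hk hn ht
    by_cases h2 : C.card ≤ 2
    · exact hQ C t h2 ht
    obtain ⟨b, hb⟩ : ∃ b, b ∉ insert t C := by
      by_contra! h
      have := Finset.card_eq_of_equiv_fin (s := insert t C)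
        (Equiv.subtypeUnivEquiv h)
      rw [Finset.card_insert_of_notMem ht] at this
      omega
    obtain ⟨c, hc⟩ : C.Nonempty := Finset.card_pos.1 (by omega)
    rw [Finset.mem_insert, not_or] at hb
    have hbc : c ≠ b := fun h => hb.2 (h ▸ hc)
    have htc : c ≠ t := fun h => ht (h ▸ hc)
    have hcard := Finset.card_erase_of_mem hc
    have hbA : b ∉ C.erase c := fun h => hb.2 (Finset.mem_of_mem_erase h)
    have m1 : ctrlNot (C.erase c) b ∈ Q := ih _ (by omega) _ _ rfl (by omega) hbA
    have m2 : ctrlNot {c, b} t ∈ Q := by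
      refine hQ _ _ Finset.card_le_two ?_
      simp only [Finset.mem_insert, Finset.mem_singleton, not_or]
      exact ⟨htc.symm, Ne.symm hb.1⟩
    rw [← Finset.insert_erase hc, ← ctrlNot_commutator hbA
      (fun h => ht (Finset.mem_of_mem_erase h)) hb.1 hbc htc]
    exact Q.mul_mem (Q.mul_mem (Q.mul_mem m1 m2) m1) m2

/-- A NOT gate with `n - 2` controls moves exactly the labels that are 1 off a two-element set
(target and spare qubit). For two disjoint such sets, which need `n ≥ 4`, only the all-ones label is
moved by both gates. -/
theorem exists_isThreeCycle_mem (hn : 4 ≤ n)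
    (hQ : ∀ C t, C.card ≤ 2 → t ∉ C → ctrlNot C t ∈ Q) : ∃ g ∈ Q, g.IsThreeCycle := by
  let i : Fin 4 → Fin n := Fin.castLE hn
  have hi : Function.Injective i := Fin.castLE_injective hn
  let C : Fin n → Fin n → Finset (Fin n) := fun s t => (Finset.univ.erase s).erase t
  have hmem : ∀ s t, s ≠ t → ctrlNot (C s t) t ∈ Q := by
    intro s t hst
    have hcard : (C s t).card = n - 1 - 1 := by
      rw [Finset.card_erase_of_mem (by simp [hst.symm]), Finset.card_erase_of_mem (by simp),
        Finset.card_univ, Fintype.card_fin]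
    exact ctrlNot_mem hQ _ _ _ rfl (by omega) (Finset.notMem_erase _ _)
  have h01 : i 0 ≠ i 1 := hi.ne (by decide)
  have h23 : i 2 ≠ i 3 := hi.ne (by decide)
  have m1 := hmem _ _ h01
  have m2 := hmem _ _ h23
  refine ⟨_, Q.mul_mem (Q.mul_mem (Q.mul_mem m1 m2) m1) m2,
    isThreeCycle_of_involutive (ctrlNot_ctrlNot _ _) (ctrlNot_ctrlNot _ _) (a := 1) ?_ ?_ ?_⟩
  · rw [ctrlNot_apply_ne_iff]; intros; rfl
  · rw [ctrlNot_apply_ne_iff]; intros; rfl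
  · intro x h1 h2
    rw [ctrlNot_apply_ne_iff] at h1 h2
    ext1 j
    by_cases hj : j = i 0 ∨ j = i 1
    · refine h2 j ?_ ?_
      · rcases hj with rfl | rfl <;> simp [C, hi.eq_iff]
      · rcases hj with rfl | rfl <;> simp [hi.eq_iff]
    · rw [not_or] at hj
      exact h1 j (by simp [C, hj]) hj.2

theorem exists_mem_apply_eq_zero (hQ : ∀ C t, C.card ≤ 2 → t ∉ C → ctrlNot C t ∈ Q)
    (x : Basis n) : ∃ g ∈ Q, g x = 0 := by
  suffices H : ∀ s : Finset (Fin n), ∃ g ∈ Q, ∀ j ∈ s, g x j = 0 by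
    obtain ⟨g, hg, h⟩ := H Finset.univ
    exact ⟨g, hg, funext fun j => h j (Finset.mem_univ j)⟩
  intro s
  induction s using Finset.induction_on with
  | empty => exact ⟨1, Q.one_mem, by simp⟩
  | insert t s ht ih =>
    obtain ⟨g, hg, h⟩ := ih
    by_cases h0 : g x t = 0
    · exact ⟨g, hg, (Finset.forall_mem_insert _ _ _).2 ⟨h0, h⟩⟩
    · refine ⟨ctrlNot ∅ t * g, Q.mul_mem (hQ ∅ t (by simp) (by simp)) hg, ?_⟩
      refine (Finset.forall_mem_insert _ _ _).2 ⟨?_, fun j hj => ?_⟩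
      · rw [Perm.mul_apply, ctrlNot_apply_self, if_pos (by simp)]
        revert h0; generalize g x t = a; revert a; decide
      · rw [Perm.mul_apply, ctrlNot_apply_of_ne _ (by rintro rfl; exact ht hj), h j hj]

/-- A nonzero bit `c` of `y` serves as control of `CX` gates that set the other bits of `y`; the
label 0 is fixed because its control bit is 0. -/
theorem exists_mem_apply_eq_one (hQ : ∀ C t, C.card ≤ 2 → t ∉ C → ctrlNot C t ∈ Q)
    {y : Basis n} (hy : y ≠ 0) : ∃ g ∈ Q, g 0 = 0 ∧ g y = 1 := by
  obtain ⟨c, hc⟩ := Function.ne_iff.1 hy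
  have hc : y c = 1 := by
    revert hc; rw [Pi.zero_apply]; generalize y c = a; revert a; decide
  suffices H : ∀ s : Finset (Fin n), ∃ g ∈ Q, g 0 = 0 ∧ g y c = 1 ∧ ∀ j ∈ s, g y j = 1 by
    obtain ⟨g, hg, h0, -, h⟩ := H Finset.univ
    exact ⟨g, hg, h0, funext fun j => h j (Finset.mem_univ j)⟩
  intro s
  induction s using Finset.induction_on with
  | empty => exact ⟨1, Q.one_mem, rfl, hc, by simp⟩
  | insert t s ht ih =>
    obtain ⟨g, hg, h0, h1, h⟩ := ih
    by_cases hgt : g y t = 1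
    · exact ⟨g, hg, h0, h1, (Finset.forall_mem_insert _ _ _).2 ⟨hgt, h⟩⟩
    · have hct : c ≠ t := by rintro rfl; exact hgt h1
      refine ⟨ctrlNot {c} t * g, Q.mul_mem (hQ {c} t (by simp) (by simpa using hct.symm)) hg,
        ?_, ?_, ?_⟩
      · rw [Perm.mul_apply, h0]
        by_contra h'
        rw [← ne_eq, ctrlNot_apply_ne_iff] at h'
        simpa using h' c (by simp) hct
      · rw [Perm.mul_apply, ctrlNot_apply_of_ne _ hct, h1]
      refine (Finset.forall_mem_insert _ _ _).2 ⟨?_, fun j hj => ?_⟩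
      · rw [Perm.mul_apply, ctrlNot_apply_self, if_pos (by simpa using fun _ => h1)]
        revert hgt; generalize g y t = a; revert a; decide
      · rw [Perm.mul_apply, ctrlNot_apply_of_ne _ (by rintro rfl; exact ht hj), h j hj]

theorem exists_mem_apply_eq_apply_eq (hQ : ∀ C t, C.card ≤ 2 → t ∉ C → ctrlNot C t ∈ Q)
    {a b c d : Basis n} (hab : a ≠ b) (hcd : c ≠ d) : ∃ g ∈ Q, g a = c ∧ g b = d := by
  have key : ∀ {a b : Basis n}, a ≠ b → ∃ g ∈ Q, g a = 0 ∧ g b = 1 := by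
    intro a b hab
    obtain ⟨g, hg, hga⟩ := exists_mem_apply_eq_zero hQ a
    obtain ⟨h, hh, h0, h1⟩ := exists_mem_apply_eq_one hQ (y := g b)
      (by rw [← hga]; exact g.injective.ne hab.symm)
    exact ⟨h * g, Q.mul_mem hh hg, by rw [Perm.mul_apply, hga, h0], h1⟩
  obtain ⟨g, hg, ga, gb⟩ := key hab
  obtain ⟨h, hh, hc, hd⟩ := key hcd
  refine ⟨h⁻¹ * g, Q.mul_mem (Q.inv_mem hh) hg, ?_, ?_⟩
  · rw [Perm.mul_apply, ga, Perm.inv_eq_iff_eq, hc]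
  · rw [Perm.mul_apply, gb, Perm.inv_eq_iff_eq, hd]

/-- For `n ≥ 4`, the gates `X`, `CX` and `CCX` generate all even permutations of the basis. -/
theorem alternatingGroup_le (hn : 4 ≤ n)
    (hQ : ∀ C t, C.card ≤ 2 → t ∉ C → ctrlNot C t ∈ Q) : alternatingGroup (Basis n) ≤ Q := by
  obtain ⟨g, hg, h3⟩ := exists_isThreeCycle_mem hn hQ
  refine Perm.alternatingGroup_le_of_isPreprimitive_of_isThreeCycle_mem
    (MulAction.isPreprimitive_of_is_two_pretransitive ?_) h3 hg
  rw [MulAction.is_two_pretransitive_iff]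
  intro a b c d hab hcd
  obtain ⟨g, hg, h1, h2⟩ := exists_mem_apply_eq_apply_eq hQ hab hcd
  exact ⟨⟨g, hg⟩, h1, h2⟩

end Permutations

/-! ### Gates as tensor factors; determinants, entries and inverses of circuits -/

section Gates

open Equiv Kronecker

variable {n k : ℕ}

open Classical in
/-- Splitting a basis label into the part on the qubits `f` and the rest. -/
noncomputable def splitEquiv (f : Fin k ↪ Fin n) :
    Basis n ≃ Basis k × ({j // ¬ j ∈ Set.range f} → Fin 2) :=
  (Equiv.piEquivPiSubtypeProd (· ∈ Set.range f) fun _ => Fin 2).trans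
    (Equiv.prodCongr
      (Equiv.arrowCongr (Equiv.ofInjective f f.injective).symm (Equiv.refl (Fin 2)))
      (Equiv.refl _))

open Classical in
theorem onQubits_eq_submatrix (f : Fin k ↪ Fin n) (U : QMatrix k) :
    onQubits f U = (U ⊗ₖ (1 : Matrix ({j // ¬ j ∈ Set.range f} → Fin 2) _ ℂ)).submatrix
      (splitEquiv f) (splitEquiv f) := by
  ext x y
  rw [Matrix.submatrix_apply, Matrix.kronecker_apply, Matrix.one_apply, onQubits, Matrix.of_apply]
  have h : (∀ j, j ∉ Set.range f → x j = y j) ↔ (splitEquiv f x).2 = (splitEquiv f y).2 := by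
    rw [funext_iff, Subtype.forall]
    rfl
  simp only [h, mul_ite, mul_one, mul_zero]
  rfl

theorem onQubits_mul (f : Fin k ↪ Fin n) (A B : QMatrix k) :
    onQubits f (A * B) = onQubits f A * onQubits f B := by
  classical
  rw [onQubits_eq_submatrix, onQubits_eq_submatrix, onQubits_eq_submatrix,
    Matrix.submatrix_mul_equiv, ← Matrix.mul_kronecker_mul, mul_one]

theorem onQubits_one (f : Fin k ↪ Fin n) : onQubits f (1 : QMatrix k) = 1 := by
  classical
  rw [onQubits_eq_submatrix, Matrix.one_kronecker_one, Matrix.submatrix_one_equiv]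

theorem onQubits_pow (f : Fin k ↪ Fin n) (A : QMatrix k) (m : ℕ) :
    onQubits f (A ^ m) = onQubits f A ^ m := by
  induction m with
  | zero => rw [pow_zero, pow_zero, onQubits_one]
  | succ m ih => rw [pow_succ, pow_succ, onQubits_mul, ih]

theorem star_onQubits (f : Fin k ↪ Fin n) (A : QMatrix k) :
    star (onQubits f A) = onQubits f (star A) := by
  classical
  rw [onQubits_eq_submatrix, onQubits_eq_submatrix, Matrix.star_eq_conjTranspose,
    Matrix.star_eq_conjTranspose, Matrix.conjTranspose_submatrix, Matrix.conjTranspose_kronecker,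
    Matrix.conjTranspose_one]

theorem det_onQubits (f : Fin k ↪ Fin n) (A : QMatrix k) :
    (onQubits f A).det = A.det ^ 2 ^ (n - k) := by
  classical
  rw [onQubits_eq_submatrix, Matrix.det_submatrix_equiv_self, Matrix.det_kronecker,
    Matrix.det_one, one_pow, mul_one, Fintype.card_fun, Fintype.card_fin,
    Fintype.card_subtype_compl, Fintype.card_fin]
  congr 3
  rw [← Fintype.card_congr (Equiv.ofInjective f f.injective), Fintype.card_fin]

theorem onQubits_mem (f : Fin k ↪ Fin n) {A : QMatrix k} (hA : ∀ x y, A x y ∈ DyadicGaussian)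
    (x y : Basis n) : onQubits f A x y ∈ DyadicGaussian := by
  rw [onQubits, Matrix.of_apply]
  split_ifs
  · exact hA _ _
  · exact DyadicGaussian.zero_mem

/-- A one-qubit matrix is a relabelled `2 × 2` matrix. -/
theorem oneQubit_eq_submatrix (M : Matrix (Fin 2) (Fin 2) ℂ) :
    oneQubit M = M.submatrix (Equiv.funUnique (Fin 1) (Fin 2)) (Equiv.funUnique (Fin 1) (Fin 2)) :=
  rfl

theorem oneQubit_mul (M N : Matrix (Fin 2) (Fin 2) ℂ) :
    oneQubit (M * N) = oneQubit M * oneQubit N := by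
  rw [oneQubit_eq_submatrix, oneQubit_eq_submatrix, oneQubit_eq_submatrix,
    Matrix.submatrix_mul_equiv]

theorem oneQubit_one : oneQubit 1 = 1 := by
  rw [oneQubit_eq_submatrix, Matrix.submatrix_one_equiv]

theorem oneQubit_pow (M : Matrix (Fin 2) (Fin 2) ℂ) (m : ℕ) :
    oneQubit (M ^ m) = oneQubit M ^ m := by
  induction m with
  | zero => rw [pow_zero, pow_zero, oneQubit_one]
  | succ m ih => rw [pow_succ, pow_succ, oneQubit_mul, ih]

theorem onQubits_ctrlNot (f : Fin k ↪ Fin n) (C : Finset (Fin k)) (t : Fin k) :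
    onQubits f (embedCols (ctrlNot C t)) = embedCols (ctrlNot (C.map f) (f t)) := by
  ext x y
  rw [embedCols_apply, onQubits, Matrix.of_apply, embedCols_apply]
  have hC : (∀ c ∈ C.map f, c ≠ f t → y c = 1) ↔ ∀ c ∈ C, c ≠ t → y (f c) = 1 := by
    simp [f.injective.eq_iff]
  have h : x = ctrlNot (C.map f) (f t) y ↔ (∀ j, j ∉ Set.range f → x j = y j) ∧
      (fun a => x (f a)) = ctrlNot C t (fun a => y (f a)) := by
    constructor
    · rintro rfl
      refine ⟨fun j hj => ctrlNot_apply_of_ne _ (fun h => hj ⟨t, h.symm⟩) y, funext fun a => ?_⟩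
      by_cases ha : a = t
      · subst ha
        rw [ctrlNot_apply_self, ctrlNot_apply_self]
        simp only [hC]
      · rw [ctrlNot_apply_of_ne _ (f.injective.ne ha), ctrlNot_apply_of_ne _ ha]
    · rintro ⟨h1, h2⟩
      ext1 j
      by_cases hj : j ∈ Set.range f
      · obtain ⟨a, rfl⟩ := hj
        have := congrFun h2 a
        by_cases ha : a = t
        · subst ha
          rw [ctrlNot_apply_self] at this ⊢
          simp only [hC]
          exact this
        · rw [ctrlNot_apply_of_ne _ ha] at this
          rw [ctrlNot_apply_of_ne _ (f.injective.ne ha)]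
          exact this
      · rw [h1 j hj, ctrlNot_apply_of_ne _ (fun h => hj ⟨t, h.symm⟩)]
  simp only [h]
  split_ifs <;> first | rfl | tauto

theorem controlled_ctrlNot (C : Finset (Fin k)) (t : Fin k) :
    controlled (embedCols (ctrlNot C t))
      = embedCols (ctrlNot (insert 0 (C.map (Fin.succEmb k))) t.succ) := by
  ext x y
  rw [embedCols_apply, controlled, Matrix.of_apply, embedCols_apply, Matrix.one_apply]
  set z := ctrlNot (insert 0 (C.map (Fin.succEmb k))) t.succ y with hz
  have hC : (∀ c ∈ insert 0 (C.map (Fin.succEmb k)), c ≠ t.succ → y c = 1) ↔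
      y 0 = 1 ∧ ∀ c ∈ C, c ≠ t → Fin.tail y c = 1 := by
    simp [Fin.tail, (Fin.succ_ne_zero t).symm]
  have z0 : z 0 = y 0 := ctrlNot_apply_of_ne _ (Fin.succ_ne_zero t).symm y
  have zt : Fin.tail z = if y 0 = 1 then ctrlNot C t (Fin.tail y) else Fin.tail y := by
    ext1 j
    by_cases hj : j = t
    · subst hj
      change z j.succ = _
      rw [hz, ctrlNot_apply_self]
      simp only [hC]
      by_cases h : y 0 = 1
      · rw [if_pos h, ctrlNot_apply_self]
        simp only [h, true_and]
        rfl
      · rw [if_neg h, if_neg fun h' => h h'.1]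
        rfl
    · change z j.succ = _
      rw [hz, ctrlNot_apply_of_ne _ ((Fin.succ_injective k).ne hj)]
      split_ifs
      · rw [ctrlNot_apply_of_ne _ hj]; rfl
      · rfl
  have h : x = z ↔ x 0 = y 0 ∧ Fin.tail x = Fin.tail z := by
    constructor
    · rintro rfl; exact ⟨z0, rfl⟩
    · rintro ⟨h1, h2⟩
      rw [← Fin.cons_self_tail x, ← Fin.cons_self_tail z, h2, h1, z0]
  simp only [h, zt]
  by_cases h0 : x 0 = y 0
  · simp only [h0, if_true, true_and]
    generalize y 0 = a
    fin_cases a <;> simp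
  · simp [h0]

theorem oneQubit_matX : oneQubit matX = embedCols (ctrlNot (∅ : Finset (Fin 1)) 0) := by
  ext x y
  rw [embedCols_apply]
  have h : x = ctrlNot ∅ 0 y ↔ x 0 = y 0 + 1 := by
    rw [funext_iff, Fin.forall_fin_one, ctrlNot_apply_self, if_pos (by simp)]
  simp only [h]
  change matX (x 0) (y 0) = _
  generalize x 0 = a, y 0 = b
  fin_cases a <;> fin_cases b <;> simp [matX]

theorem matrix_X : Gate.matrix .X = embedCols (ctrlNot (∅ : Finset (Fin 1)) 0) := oneQubit_matX

theorem matrix_CX : Gate.matrix .CX = embedCols (ctrlNot ({0} : Finset (Fin 2)) 1) := by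
  change controlled (Gate.matrix .X) = _
  rw [matrix_X]
  exact controlled_ctrlNot _ _

theorem matrix_CCX : Gate.matrix .CCX = embedCols (ctrlNot ({0, 1} : Finset (Fin 3)) 2) := by
  change controlled (Gate.matrix .CX) = _
  rw [matrix_CX]
  exact controlled_ctrlNot _ _

/-- Since `ω = (1 + i) / √2`, the phase removes `√2` and brings the entries of the Hadamard gate
into `ℤ[1/2, i]`. -/
theorem omega_smul_matH : omega • matH = unitaryK.1 := by
  have h2 : ((√2 : ℝ) : ℂ) * ((√2 : ℝ) : ℂ) = 2 := by
    rw [← Complex.ofReal_mul, Real.mul_self_sqrt (by norm_num)]; norm_num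
  have h0 : ((√2 : ℝ) : ℂ) ≠ 0 := by
    intro h; rw [h] at h2; norm_num at h2
  have hω : omega * (1 / ((√2 : ℝ) : ℂ)) = (1 + Complex.I) / 2 := by
    have : omega = ((√2 : ℝ) : ℂ) / 2 * (1 + Complex.I) := by
      rw [omega, mul_comm, Complex.exp_mul_I]
      have e : (Real.pi / 4 : ℂ) = ((Real.pi / 4 : ℝ) : ℂ) := by push_cast; rfl
      rw [e, ← Complex.ofReal_cos, ← Complex.ofReal_sin, Real.cos_pi_div_four,
        Real.sin_pi_div_four]
      push_cast
      ring
    rw [this]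
    field_simp
  rw [matH, smul_smul, hω]
  ext i j
  fin_cases i <;> fin_cases j <;> simp [unitaryK]

theorem unitaryK_sq : unitaryK.1 ^ 2 = Complex.I • (1 : Matrix (Fin 2) (Fin 2) ℂ) := by
  rw [pow_two]
  ext i j
  fin_cases i <;> fin_cases j <;> simp [unitaryK, Matrix.mul_apply, Fin.sum_univ_two] <;>
    linear_combination (1 / 2 : ℂ) * Complex.I_mul_I

theorem matS_eq_diagonal : matS = Matrix.diagonal ![1, Complex.I] := by
  ext i j
  fin_cases i <;> fin_cases j <;> simp [matS]

theorem embedCols_ctrlNot_sq (C : Finset (Fin n)) (t : Fin n) :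
    embedCols (ctrlNot C t) ^ 2 = 1 := by
  rw [pow_two, mul_embedCols]
  ext x y
  rw [Matrix.submatrix_apply, embedCols_apply, ctrlNot_ctrlNot, Matrix.one_apply, id]

theorem oneQubit_omega_smul_matH_pow : oneQubit (omega • matH) ^ 2 ^ 3 = 1 := by
  rw [← oneQubit_pow, omega_smul_matH, show 2 ^ 3 = 2 * 4 by rfl, pow_mul, unitaryK_sq,
    smul_pow, one_pow, Complex.I_pow_four, one_smul, oneQubit_one]

theorem oneQubit_matS_pow : oneQubit matS ^ 2 ^ 2 = 1 := by
  rw [← oneQubit_pow, matS_eq_diagonal, Matrix.diagonal_pow, ← oneQubit_one,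
    ← Matrix.diagonal_one]
  congr 2
  ext i
  fin_cases i <;> simp

/-- Divisibility serves the determinant, which is raised to the power `2 ^ (n - arity)` on `n`
qubits; positivity of `m` serves to write the inverse of a gate as a power. -/
theorem exists_matrix_pow_eq_one (hn : 4 ≤ n) (g : Gate) :
    ∃ m : ℕ, 0 < m ∧ m ∣ 2 ^ (n - g.arity) ∧ g.matrix ^ m = 1 := by
  cases g with
  | X => exact ⟨2, by norm_num, dvd_pow_self 2 (by simp only [Gate.arity]; omega),
      by rw [matrix_X]; exact embedCols_ctrlNot_sq _ _⟩
  | CX => exact ⟨2, by norm_num, dvd_pow_self 2 (by simp only [Gate.arity]; omega),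
      by rw [matrix_CX]; exact embedCols_ctrlNot_sq _ _⟩
  -- Here `n ≥ 4` is sharp: for `n = 3` the exponent `2 ^ (n - 3)` is odd.
  | CCX => exact ⟨2, by norm_num, dvd_pow_self 2 (by simp only [Gate.arity]; omega),
      by rw [matrix_CCX]; exact embedCols_ctrlNot_sq _ _⟩
  | omegaH =>
    refine ⟨2 ^ 3, by norm_num, pow_dvd_pow 2 (by simp only [Gate.arity]; omega), ?_⟩
    exact oneQubit_omega_smul_matH_pow
  | S =>
    refine ⟨2 ^ 2, by norm_num, pow_dvd_pow 2 (by simp only [Gate.arity]; omega), ?_⟩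
    exact oneQubit_matS_pow

theorem I_mem_dyadicGaussian : Complex.I ∈ DyadicGaussian :=
  ⟨0, Dyadic.zero_mem, 1, Dyadic.one_mem, by simp⟩

theorem embedCols_mem {ι κ : Type*} [DecidableEq ι] (f : κ → ι) (x : ι) (i : κ) :
    embedCols f x i ∈ DyadicGaussian := by
  rw [embedCols_apply]
  split_ifs
  · exact DyadicGaussian.one_mem
  · exact DyadicGaussian.zero_mem

theorem oneQubit_mem {M : Matrix (Fin 2) (Fin 2) ℂ} (hM : ∀ i j, M i j ∈ DyadicGaussian)
    (x y : Basis 1) : oneQubit M x y ∈ DyadicGaussian := hM _ _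

theorem matrix_mem_dyadicGaussian (g : Gate) (x y : Basis g.arity) :
    g.matrix x y ∈ DyadicGaussian := by
  cases g with
  | X => rw [matrix_X]; exact embedCols_mem _ _ _
  | CX => rw [matrix_CX]; exact embedCols_mem _ _ _
  | CCX => rw [matrix_CCX]; exact embedCols_mem _ _ _
  | omegaH =>
    refine oneQubit_mem (fun a b => ?_) x y
    rw [omega_smul_matH]
    have h : (1 + Complex.I) / 2 ∈ DyadicGaussian :=
      ⟨1 / 2, ⟨1, 1, by norm_num⟩, 1 / 2, ⟨1, 1, by norm_num⟩, by push_cast; ring⟩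
    fin_cases a <;> fin_cases b <;> first | exact h | exact DyadicGaussian.neg_mem h
  | S =>
    refine oneQubit_mem (fun a b => ?_) x y
    fin_cases a <;> fin_cases b <;>
      first
        | exact DyadicGaussian.one_mem
        | exact DyadicGaussian.zero_mem
        | exact I_mem_dyadicGaussian

theorem matrix_append (C D : Circuit n) :
    Circuit.matrix (C ++ D) = Circuit.matrix D * Circuit.matrix C := by
  induction C with
  | nil => rw [List.nil_append, Circuit.matrix, mul_one]
  | cons p C ih => rw [List.cons_append, Circuit.matrix, Circuit.matrix, ih, mul_assoc]

theorem det_circuit (hn : 4 ≤ n) (C : Circuit n) : C.matrix.det = 1 := by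
  induction C with
  | nil => rw [Circuit.matrix, Matrix.det_one]
  | cons p C ih =>
    obtain ⟨m, -, ⟨d, hd⟩, hm⟩ := exists_matrix_pow_eq_one hn p.gate
    rw [Circuit.matrix, Matrix.det_mul, ih, one_mul, det_onQubits, hd, pow_mul, ← Matrix.det_pow,
      hm, Matrix.det_one, one_pow]

theorem circuit_matrix_mem (C : Circuit n) (x y : Basis n) : C.matrix x y ∈ DyadicGaussian := by
  induction C generalizing x y with
  | nil =>
    rw [Circuit.matrix, Matrix.one_apply]
    split_ifs
    · exact DyadicGaussian.one_mem
    · exact DyadicGaussian.zero_mem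
  | cons p C ih =>
    rw [Circuit.matrix, Matrix.mul_apply]
    exact sum_mem fun z _ =>
      mul_mem (ih x z) (onQubits_mem _ (matrix_mem_dyadicGaussian p.gate) z y)

theorem matrix_replicate (p : PlacedGate n) (m : ℕ) :
    Circuit.matrix (List.replicate m p) = onQubits p.wires p.gate.matrix ^ m := by
  induction m with
  | zero => rfl
  | succ m ih => rw [List.replicate_succ, Circuit.matrix, ih, pow_succ]

theorem exists_circuit_inv (hn : 4 ≤ n) (C : Circuit n) :
    ∃ D : Circuit n, D.matrix * C.matrix = 1 := by
  induction C with
  | nil => exact ⟨[], one_mul _⟩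
  | cons p C ih =>
    obtain ⟨D, hD⟩ := ih
    obtain ⟨m, hm0, -, hm⟩ := exists_matrix_pow_eq_one hn p.gate
    refine ⟨D ++ List.replicate (m - 1) p, ?_⟩
    rw [matrix_append, matrix_replicate, Circuit.matrix, mul_assoc, ← mul_assoc (Circuit.matrix D),
      hD, one_mul, ← pow_succ, Nat.sub_add_cancel hm0, ← onQubits_pow, hm, onQubits_one]

/-- The group of the unitary matrices represented by ancilla-free circuits. -/
noncomputable def circuitGroup (hn : 4 ≤ n) : Subgroup (Matrix.unitaryGroup (Basis n) ℂ) where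
  carrier := {U | IsAncillaFreeRepresentable U.1}
  one_mem' := ⟨[], rfl⟩
  mul_mem' := by
    rintro U V ⟨C, hC⟩ ⟨D, hD⟩
    exact ⟨D ++ C, by rw [matrix_append, hC, hD]; rfl⟩
  inv_mem' := by
    rintro U ⟨C, hC⟩
    obtain ⟨D, hD⟩ := exists_circuit_inv hn C
    refine ⟨D, ?_⟩
    rw [hC] at hD
    exact left_inv_eq_right_inv hD (Matrix.mem_unitaryGroup_iff.1 U.2)

theorem mem_circuitGroup_of_eq (hn : 4 ≤ n) {U : Matrix.unitaryGroup (Basis n) ℂ} (g : Gate)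
    (f : Fin g.arity ↪ Fin n) (h : U.1 = onQubits f g.matrix) : U ∈ circuitGroup hn :=
  ⟨[⟨g, f⟩], by rw [h, Circuit.matrix, Circuit.matrix, one_mul]⟩

end Gates

/-! ### Isolating one block among commuting copies -/

section Commutators

/-- Two commuting copies of `k` can be separated from each other, at the cost of a phase, by means
of a third copy of the group that commutes with both. -/
theorem mul_map_mem_of_conj {U₂ U : Type*} [Group U₂] [Group U] (G : Subgroup U) (P Q R : U₂ →* U)
    (hPQ : ∀ a b, Commute (P a) (Q b)) (hPR : ∀ a b, Commute (P a) (R b))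
    (hQR : ∀ a b, Commute (Q a) (R b)) {s k : U₂} (hs : s ^ 4 = 1) (hk : s * (k * s * k⁻¹) * s = k)
    {h : U} (hG : h ∈ G) (hP : h * P s * h⁻¹ = P (k * s * k⁻¹))
    (hQ : h * Q s * h⁻¹ = Q (k * s * k⁻¹)) (h1 : P s * (Q s)⁻¹ ∈ G) (h2 : P s * (R s)⁻¹ ∈ G) :
    P k * R s ∈ G := by
  let Φ := P.noncommCoprod Q hPQ
  let Ψ := P.noncommCoprod R hPR
  have hT : P k * (Q k)⁻¹ ∈ G := by
    have e1 : P s * (Q s)⁻¹ = Φ (s, s⁻¹) := by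
      rw [← map_inv]; rfl
    have e2 : h * (P s * (Q s)⁻¹) * h⁻¹ = Φ (k * s * k⁻¹, (k * s * k⁻¹)⁻¹) := by
      have : Φ (k * s * k⁻¹, (k * s * k⁻¹)⁻¹) = P (k * s * k⁻¹) * (Q (k * s * k⁻¹))⁻¹ := by
        rw [← map_inv]; rfl
      rw [this, ← hP, ← hQ]
      group
    -- In the `P` copy this is `s (k s k⁻¹) s = k`; in the `Q` copy every factor is inverted and the
    -- palindromic order gives `k⁻¹`.
    have e3 : P s * (Q s)⁻¹ * (h * (P s * (Q s)⁻¹) * h⁻¹) * (P s * (Q s)⁻¹) = P k * (Q k)⁻¹ := by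
      have : P k * (Q k)⁻¹ = Φ (k, k⁻¹) := by rw [← map_inv]; rfl
      rw [e2, e1, ← map_mul, ← map_mul, this]
      congr 1
      refine Prod.ext hk ?_
      change s⁻¹ * (k * s * k⁻¹)⁻¹ * s⁻¹ = k⁻¹
      rw [← mul_inv_rev, ← mul_inv_rev, ← mul_assoc, hk]
    rw [← e3]
    exact G.mul_mem (G.mul_mem h1 (G.mul_mem (G.mul_mem hG h1) (G.inv_mem hG))) h1
  have e1 : P s * (R s)⁻¹ = Ψ (s, s⁻¹) := by
    rw [← map_inv]; rfl
  have e2 : P k * (Q k)⁻¹ * (P s * (R s)⁻¹) * (P k * (Q k)⁻¹)⁻¹ = Ψ (k * s * k⁻¹, s⁻¹) := by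
    have c : Commute (Q k) (P s * (R s)⁻¹) := (hPQ s k).symm.mul_right (hQR k s).inv_right
    have c' : (Q k)⁻¹ * (P s * (R s)⁻¹) * Q k = P s * (R s)⁻¹ := by
      rw [mul_assoc, ← c.eq, inv_mul_cancel_left]
    have e : Ψ (k, 1) = P k := by
      change P k * R 1 = P k
      rw [map_one, mul_one]
    calc _ = P k * ((Q k)⁻¹ * (P s * (R s)⁻¹) * Q k) * (P k)⁻¹ := by group
      _ = Ψ ((k, 1) * (s, s⁻¹) * (k, 1)⁻¹) := by rw [c', e1, ← e, map_mul, map_mul, map_inv]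
      _ = _ := by
        congr 1
        ext
        · rfl
        · change 1 * s⁻¹ * 1⁻¹ = s⁻¹
          simp
  -- Now `P k * (Q k)⁻¹` replaces `h` as conjugator: it acts by `k` on the `P` copy but trivially on
  -- the `R` copy, which therefore collects `s⁻³ = s`.
  have e3 : P s * (R s)⁻¹ * (P k * (Q k)⁻¹ * (P s * (R s)⁻¹) * (P k * (Q k)⁻¹)⁻¹) *
      (P s * (R s)⁻¹) = P k * R s := by
    have e : P k * R s = Ψ (k, s) := rfl
    rw [e2, e1, ← map_mul, ← map_mul, e]
    congr 1
    refine Prod.ext hk ?_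
    change s⁻¹ * s⁻¹ * s⁻¹ = s
    rw [← mul_inv_rev, ← mul_inv_rev, inv_eq_iff_mul_eq_one, ← hs]
    simp only [pow_succ, pow_zero, one_mul, mul_assoc]
  rw [← e3]
  exact G.mul_mem (G.mul_mem h2 (G.mul_mem (G.mul_mem hT h2) (G.inv_mem hT))) h2

end Commutators

/-! ### Conjugation by permutation matrices -/

section PermutationMatrices

variable {ι κ : Type*} [Fintype ι] [DecidableEq ι] [Fintype κ] [DecidableEq κ]

/-- Permutation matrices. -/
def permHom : Equiv.Perm ι →* Matrix.unitaryGroup ι ℂ where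
  toFun σ := ⟨embedCols σ, by
    rw [Matrix.mem_unitaryGroup_iff', Matrix.star_eq_conjTranspose]
    exact conjTranspose_embedCols_mul_self σ.toEmbedding⟩
  map_one' := Subtype.ext (by
    ext x y
    simp [embedCols_apply, Matrix.one_apply])
  map_mul' σ τ := Subtype.ext (by
    change embedCols (σ * τ) = embedCols σ * embedCols τ
    rw [mul_embedCols]
    ext x y
    simp [embedCols_apply])

theorem permHom_conj_blockHom (σ : Equiv.Perm ι) (f : κ ↪ ι) (A : Matrix.unitaryGroup κ ℂ) :
    permHom σ * blockHom f A * (permHom σ)⁻¹ = blockHom (f.trans σ.toEmbedding) A := by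
  rw [conj_blockHom _ f (f.trans σ.toEmbedding) 1, one_mul, inv_one, mul_one]
  change embedCols σ * embedCols f = embedCols (f.trans σ.toEmbedding) * (1 : Matrix κ κ ℂ)
  rw [Matrix.mul_one, mul_embedCols]
  ext x y
  simp [embedCols_apply]

theorem permHom_conj_diagHom (σ : Equiv.Perm ι) (φ : ι → unitary ℂ) :
    permHom σ * diagHom φ * (permHom σ)⁻¹ = diagHom (φ ∘ σ.symm) := by
  rw [mul_inv_eq_iff_eq_mul]
  apply Subtype.ext
  change embedCols σ * Matrix.diagonal _ = Matrix.diagonal _ * embedCols σ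
  ext x y
  rw [Matrix.mul_diagonal, Matrix.diagonal_mul, embedCols_apply]
  by_cases h : x = σ y
  · subst h; simp
  · simp [h]

theorem permHom_conj_phase (σ : Equiv.Perm ι) (c : ι) :
    permHom σ * phase c * (permHom σ)⁻¹ = phase (σ c) := by
  rw [phase, permHom_conj_diagHom, phase]
  congr 1
  ext1 x
  by_cases h : x = σ c
  · subst h; simp
  · have h' : σ.symm x ≠ c := fun e => h (by rw [← e, Equiv.apply_symm_apply])
    simp [h, h']

theorem blockHom_phase (f : κ ↪ ι) (i : κ) : blockHom f (phase i) = phase (f i) := by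
  apply Subtype.ext
  have h : (phase i).1 - 1 = Matrix.single i i (Complex.I - 1) := by
    ext a b
    by_cases hab : a = b
    · subst hab
      by_cases ha : a = i
      · subst ha; simp [phase]
      · simp [phase, ha, Matrix.single_apply_of_ne, Ne.symm ha]
    · have : ¬ (i = a ∧ i = b) := by rintro ⟨rfl, rfl⟩; exact hab rfl
      simp [phase, hab, Matrix.single_apply_of_ne _ _ _ _ _ this]
  rw [coe_blockHom, blockMat, h, phase, coe_diagHom]
  ext x y
  rw [Matrix.add_apply, Matrix.mul_apply, Finset.sum_eq_single i]
  · by_cases hxy : x = y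
    · subst hxy
      by_cases hx : x = f i
      · subst hx; simp [embedCols_apply]
      · simp [embedCols_apply, hx]
    · by_cases hx : x = f i
      · subst hx; simp [embedCols_apply, hxy, Ne.symm hxy]
      · simp [embedCols_apply, hxy, hx]
  · intro j _ hj
    rw [Matrix.mul_single_apply_of_ne _ _ _ _ _ hj, zero_mul]
  · simp

end PermutationMatrices

/-! ### Circuits for phase ratios and two-level `ωH` -/

section Generation

variable {n : ℕ}

theorem permHom_ctrlNot_mem (hn : 4 ≤ n) (C : Finset (Fin n)) (t : Fin n) (hC : C.card ≤ 2)
    (ht : t ∉ C) : permHom (ctrlNot C t) ∈ circuitGroup hn := by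
  rcases Nat.lt_or_ge C.card 1 with h | h
  · obtain rfl := Finset.card_eq_zero.1 (Nat.lt_one_iff.1 h)
    let f : Fin 1 ↪ Fin n := ⟨fun _ => t, fun _ _ _ => Subsingleton.elim _ _⟩
    have e := onQubits_ctrlNot f ∅ 0
    rw [Finset.map_empty, ← oneQubit_matX] at e
    exact mem_circuitGroup_of_eq hn .X f e.symm
  rcases Nat.lt_or_ge C.card 2 with h' | h'
  · obtain ⟨c, rfl⟩ := Finset.card_eq_one.1 (show C.card = 1 by omega)
    rw [Finset.mem_singleton] at ht
    have e := onQubits_ctrlNot (pairEmb (Ne.symm ht)) {0} 1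
    rw [Finset.map_singleton, ← matrix_CX] at e
    exact mem_circuitGroup_of_eq hn .CX (pairEmb (Ne.symm ht)) e.symm
  · obtain ⟨c, d, hcd, rfl⟩ := Finset.card_eq_two.1 (show C.card = 2 by omega)
    rw [Finset.mem_insert, Finset.mem_singleton, not_or] at ht
    let f : Fin 3 ↪ Fin n := ⟨![c, d, t], by
      intro i j
      fin_cases i <;> fin_cases j <;> simp [hcd, hcd.symm, ht, Ne.symm ht.1, Ne.symm ht.2]⟩
    have e := onQubits_ctrlNot f {0, 1} 2
    rw [Finset.map_insert, Finset.map_singleton, ← matrix_CCX] at e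
    exact mem_circuitGroup_of_eq hn .CCX f e.symm

theorem diagHom_bit_mem (hn : 4 ≤ n) (t : Fin n) :
    diagHom (fun x : Basis n => if x t = 1 then unitI else 1) ∈ circuitGroup hn := by
  refine mem_circuitGroup_of_eq hn .S
    ⟨fun _ : Fin 1 => t, fun _ _ _ => Subsingleton.elim (α := Fin 1) _ _⟩ ?_
  have key : ∀ f : Fin 1 ↪ Fin n, onQubits f (oneQubit matS)
      = Matrix.diagonal fun x => if x (f 0) = 1 then Complex.I else 1 := by
    intro f
    have hf : ∀ j, j ∉ Set.range f ↔ j ≠ f 0 := by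
      intro j
      simp [eq_comm]
    ext x y
    rw [onQubits, Matrix.of_apply, Matrix.diagonal_apply]
    simp only [hf]
    change ite _ (matS (x (f 0)) (y (f 0))) 0 = _
    by_cases hxy : x = y
    · subst hxy
      simp only [implies_true, if_true]
      generalize x (f 0) = a
      fin_cases a <;> simp [matS]
    · rw [if_neg hxy]
      split_ifs with h
      · have : x (f 0) ≠ y (f 0) := by
          intro h'
          apply hxy
          ext1 j
          by_cases hj : j = f 0
          · rw [hj, h']
          · exact h j hj
        revert this
        generalize x (f 0) = a, y (f 0) = b
        intro hab
        fin_cases a <;> fin_cases b <;> simp [matS] at hab ⊢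
      · rfl
  refine Eq.trans ?_ (key _).symm
  rw [coe_diagHom]
  congr 1
  ext1 x
  change _ = if x t = 1 then Complex.I else 1
  split_ifs <;> rfl

/-- If `a` and `b` differ in bit `t`, then `S` on qubit `t` multiplies exactly one of them by `i`.
Dividing `S` by its conjugate under a permutation that in effect exchanges `a` and `b` leaves a
phase ratio, up to inversion. -/
theorem phase_mul_inv_phase_mem (hn : 4 ≤ n) (a b : Basis n) :
    phase a * (phase b)⁻¹ ∈ circuitGroup hn := by
  have key : ∀ (t : Fin n) (a b : Basis n), a t = 1 → b t = 0 →
      phase a * (phase b)⁻¹ ∈ circuitGroup hn := by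
    intro t a b ha hb
    obtain ⟨s, hs⟩ : ∃ s : Fin n, s ≠ t := by
      have : Nontrivial (Fin n) := Fin.nontrivial_iff_two_le.2 (by omega)
      exact exists_ne t
    set c : Basis n := Function.update b s (b s + 1) with hc
    have hct : c t = 0 := by rw [hc, Function.update_of_ne hs.symm, hb]
    have hbc : b ≠ c := by
      intro h
      have := congrFun h s
      rw [hc, Function.update_self] at this
      revert this; generalize b s = x; revert x; decide
    have hab : a ≠ b := by
      rintro rfl
      rw [ha] at hb
      exact one_ne_zero hb
    set φ : Basis n → unitary ℂ := fun x => if x t = 1 then unitI else 1 with hφ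
    -- The swap of `b` and `c` only makes `σ` even; it is invisible to `φ`, as `b` and `c` agree in
    -- bit `t`.
    set σ : Equiv.Perm (Basis n) := Equiv.swap a b * Equiv.swap b c with hσ
    have hσG : permHom σ ∈ circuitGroup hn := by
      have := alternatingGroup_le (Q := (circuitGroup hn).comap permHom) hn
        (permHom_ctrlNot_mem hn)
      refine this (x := σ) ?_
      rw [Equiv.Perm.mem_alternatingGroup, hσ, Equiv.Perm.sign_mul, Equiv.Perm.sign_swap hab,
        Equiv.Perm.sign_swap hbc]
      rfl
    have hφG := diagHom_bit_mem hn t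
    have hmem := (circuitGroup hn).mul_mem hφG ((circuitGroup hn).inv_mem
      ((circuitGroup hn).mul_mem ((circuitGroup hn).mul_mem hσG hφG)
        ((circuitGroup hn).inv_mem hσG)))
    rw [permHom_conj_diagHom, ← map_inv, ← map_mul] at hmem
    rw [phase, phase, ← map_inv, ← map_mul]
    convert hmem using 2
    have hφσ : ∀ x, φ (σ.symm x) = φ (Equiv.swap a b x) := by
      intro x
      have : σ.symm x = Equiv.swap b c (Equiv.swap a b x) := rfl
      rw [this]
      generalize Equiv.swap a b x = y
      rcases eq_or_ne y b with rfl | h1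
      · rw [Equiv.swap_apply_left]; simp [hφ, hct, hb]
      rcases eq_or_ne y c with rfl | h2
      · rw [Equiv.swap_apply_right]; simp [hφ, hct, hb]
      rw [Equiv.swap_apply_of_ne_of_ne h1 h2]
    have va : φ a = unitI := if_pos ha
    have vb : φ b = 1 := if_neg (by rw [hb]; decide)
    ext1 x
    change Pi.mulSingle (M := fun _ => unitary ℂ) a unitI x *
      (Pi.mulSingle (M := fun _ => unitary ℂ) b unitI x)⁻¹ = φ x * (φ (σ.symm x))⁻¹
    rw [hφσ]
    by_cases h1 : x = a
    · subst h1
      rw [Equiv.swap_apply_left, va, vb, Pi.mulSingle_eq_same, Pi.mulSingle_eq_of_ne hab]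
    by_cases h2 : x = b
    · subst h2
      rw [Equiv.swap_apply_right, va, vb, Pi.mulSingle_eq_same, Pi.mulSingle_eq_of_ne h1]
    rw [Equiv.swap_apply_of_ne_of_ne h1 h2, Pi.mulSingle_eq_of_ne h1, Pi.mulSingle_eq_of_ne h2,
      mul_inv_cancel, mul_inv_cancel]
  rcases eq_or_ne a b with rfl | hab
  · rw [mul_inv_cancel]; exact (circuitGroup hn).one_mem
  obtain ⟨t, ht⟩ := Function.ne_iff.1 hab
  by_cases ha : a t = 1
  · refine key t a b ha ?_
    revert ht; rw [ha]; generalize b t = x; revert x; decide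
  · have ha0 : a t = 0 := by revert ha; generalize a t = x; revert x; decide
    have := (circuitGroup hn).inv_mem (key t b a
      (by revert ht; rw [ha0]; generalize b t = x; revert x; decide) ha0)
    rwa [mul_inv_rev, inv_inv] at this

/-- The edge of the Boolean cube through `x` in direction `t`. -/
def edge (t : Fin n) (x : Basis n) : Fin 2 ↪ Basis n :=
  ⟨fun i => Function.update x t i, Function.update_injective x t⟩

theorem edge_apply (t : Fin n) (x : Basis n) (i : Fin 2) : edge t x i = Function.update x t i := rfl

theorem edge_ne_edge {t s : Fin n} (hst : s ≠ t) {x y : Basis n} (h : x s ≠ y s) (i j : Fin 2) :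
    edge t x i ≠ edge t y j := by
  intro e
  have := congrFun e s
  rw [edge_apply, edge_apply, Function.update_of_ne hst, Function.update_of_ne hst] at this
  exact h this

/-- A one-qubit gate acts by the same `2 × 2` matrix on all parallel edges of the cube, so it
conjugates the blocks on them simultaneously, by `conj_blockHom`. -/
theorem onQubits_oneQubit_mul_embedCols_edge (f : Fin 1 ↪ Fin n) (M : Matrix (Fin 2) (Fin 2) ℂ)
    (x : Basis n) : onQubits f (oneQubit M) * embedCols (edge (f 0) x)
      = embedCols (edge (f 0) x) * M := by
  have hf : ∀ j, j ∉ Set.range f ↔ j ≠ f 0 := by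
    intro j
    simp [eq_comm]
  rw [mul_embedCols]
  ext y i
  rw [Matrix.submatrix_apply, onQubits, Matrix.of_apply, Matrix.mul_apply, id]
  simp only [hf]
  change ite _ (M (y (f 0)) (edge (f 0) x i (f 0))) 0 = _
  rw [edge_apply, Function.update_self]
  split_ifs with h
  · rw [Finset.sum_eq_single (y (f 0))]
    · rw [embedCols_apply, if_pos, one_mul]
      ext1 j
      by_cases hj : j = f 0
      · subst hj; rw [edge_apply, Function.update_self]
      · rw [h j hj, edge_apply, Function.update_of_ne hj, Function.update_of_ne hj]
    · intro k _ hk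
      rw [embedCols_apply, if_neg, zero_mul]
      rintro rfl
      exact hk (by rw [edge_apply, Function.update_self])
    · simp
  · symm
    refine Finset.sum_eq_zero fun k _ => ?_
    rw [embedCols_apply, if_neg, zero_mul]
    rintro rfl
    refine h fun j hj => ?_
    rw [edge_apply, Function.update_of_ne hj, Function.update_of_ne hj]

/-- Equivalent to `S K S = K S⁻¹ K`. The two sides scale differently in `K`, and `ω` is exactly the
scalar on `H` for which the identity holds. -/
theorem phase_mul_conj_unitaryK :
    (phase 1 * (unitaryK * phase 1 * unitaryK⁻¹) * phase 1 : Matrix.unitaryGroup (Fin 2) ℂ)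
      = unitaryK := by
  have hp : (phase (1 : Fin 2)).1 = !![1, 0; 0, Complex.I] := by
    ext i j
    fin_cases i <;> fin_cases j <;> simp [phase]
  have h : phase 1 * unitaryK * phase 1 = unitaryK * (phase 1)⁻¹ * unitaryK := by
    apply Subtype.ext
    change (phase 1).1 * unitaryK.1 * (phase 1).1 = unitaryK.1 * star (phase 1).1 * unitaryK.1
    have hps : star (phase (1 : Fin 2)).1 = !![1, 0; 0, -Complex.I] := by
      rw [hp]
      ext i j
      fin_cases i <;> fin_cases j <;> simp [Matrix.star_apply]
    rw [hps, hp]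
    ext i j
    fin_cases i <;> fin_cases j <;>
      simp [unitaryK, Matrix.mul_apply, Fin.sum_univ_two] <;>
      apply Complex.ext <;> simp <;> norm_num
  rw [← mul_assoc, ← mul_assoc, h, mul_assoc _ unitaryK, mul_inv_cancel, mul_one,
    inv_mul_cancel_right]

theorem blockHom_unitaryK_mul_phase_mem (hn : 4 ≤ n) {a b : Basis n} (hab : a ≠ b) :
    ∃ c, c ≠ a ∧ c ≠ b ∧ blockHom (pairEmb hab) unitaryK * phase c ∈ circuitGroup hn := by
  let i : Fin 3 → Fin n := Fin.castLE (by omega)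
  have hi : Function.Injective i := Fin.castLE_injective _
  have h10 : i 1 ≠ i 0 := hi.ne (by decide)
  have h20 : i 2 ≠ i 0 := hi.ne (by decide)
  have h21 : i 2 ≠ i 1 := hi.ne (by decide)
  -- Three disjoint edges in the same direction give three commuting blocks on which one `ωH` gate
  -- acts alike.
  let p := edge (i 0) (0 : Basis n)
  let q := edge (i 0) (Pi.single (i 1) 1 : Basis n)
  let r := edge (i 0) (Pi.single (i 2) 1 : Basis n)
  have hpq : ∀ j k, p j ≠ q k := edge_ne_edge h10 (by simp)
  have hpr : ∀ j k, p j ≠ r k := edge_ne_edge h20 (by simp)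
  have hqr : ∀ j k, q j ≠ r k := edge_ne_edge h20 (by simp [h21])
  let f : Fin 1 ↪ Fin n := ⟨fun _ => i 0, fun _ _ _ => Subsingleton.elim _ _⟩
  let H : Matrix.unitaryGroup (Basis n) ℂ := ⟨onQubits f (oneQubit unitaryK.1), by
    have h1 : star (oneQubit unitaryK.1) = oneQubit (star unitaryK.1) := rfl
    rw [Matrix.mem_unitaryGroup_iff, star_onQubits, ← onQubits_mul, h1, ← oneQubit_mul,
      Matrix.mem_unitaryGroup_iff.1 unitaryK.2, oneQubit_one, onQubits_one]⟩
  have hH : H ∈ circuitGroup hn := by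
    refine mem_circuitGroup_of_eq hn .omegaH f ?_
    change onQubits f (oneQubit unitaryK.1) = onQubits f (oneQubit (omega • matH))
    rw [omega_smul_matH]
  have hconj : ∀ x A, H * blockHom (edge (i 0) x) A * H⁻¹
      = blockHom (edge (i 0) x) (unitaryK * A * unitaryK⁻¹) := fun x A =>
    conj_blockHom H _ _ _ _ (onQubits_oneQubit_mul_embedCols_edge f unitaryK.1 x)
  have hmem : blockHom p unitaryK * phase (r 1) ∈ circuitGroup hn := by
    rw [← blockHom_phase]
    refine mul_map_mem_of_conj _ (blockHom p) (blockHom q) (blockHom r) (commute_blockHom p q hpq)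
      (commute_blockHom p r hpr) (commute_blockHom q r hqr) (phase_pow_four 1)
      phase_mul_conj_unitaryK hH (hconj _ _) (hconj _ _) ?_ ?_
    · rw [blockHom_phase, blockHom_phase]
      exact phase_mul_inv_phase_mem hn _ _
    · rw [blockHom_phase, blockHom_phase]
      exact phase_mul_inv_phase_mem hn _ _
  -- By 2-transitivity the edge `p` is carried to the arbitrary pair `a`, `b`; the correcting phase
  -- moves along.
  obtain ⟨σ, hσ, h0, h1⟩ := exists_mem_apply_eq_apply_eq
    (Q := (circuitGroup hn).comap permHom) (permHom_ctrlNot_mem hn)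
    (p.injective.ne (show (0 : Fin 2) ≠ 1 by decide)) hab
  refine ⟨σ (r 1), ?_, ?_, ?_⟩
  · rw [← h0]; exact σ.injective.ne (hpr 0 1).symm
  · rw [← h1]; exact σ.injective.ne (hpr 1 1).symm
  · have e : pairEmb hab = p.trans σ.toEmbedding := by
      ext1 j
      fin_cases j
      · exact h0.symm
      · exact h1.symm
    rw [e, ← permHom_conj_blockHom, ← permHom_conj_phase, conj_mul]
    exact (circuitGroup hn).mul_mem ((circuitGroup hn).mul_mem hσ hmem)
      ((circuitGroup hn).inv_mem hσ)

end Generation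

end GaussianCircuit

theorem mainTheorem6 (n : ℕ) (hn : 4 ≤ n) (V : GaussianCircuit.QMatrix n)
    (hV : V ∈ GaussianCircuit.unitaryDyadicGaussian n) :
    GaussianCircuit.IsAncillaFreeRepresentable V ↔ V.det = 1 := by
  constructor
  · rintro ⟨C, rfl⟩
    exact GaussianCircuit.det_circuit hn C
  · intro hdet
    have := GaussianCircuit.mem_of_det_eq_one (G := GaussianCircuit.circuitGroup hn)
      (fun _ ⟨C, hC⟩ => hC ▸ GaussianCircuit.det_circuit hn C)
      (fun _ ⟨C, hC⟩ => hC ▸ GaussianCircuit.circuit_matrix_mem C)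
      (GaussianCircuit.phase_mul_inv_phase_mem hn)
      (fun _ _ hab => GaussianCircuit.blockHom_unitaryK_mul_phase_mem hn hab) ⟨V, hV.1⟩ hV.2 hdet
    exact this
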